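/- **Setting.** Let $d\in\{2,3\}$ and let $\Omega\subset\mathbb R^d$ be a connected, open, bounded domain. Vector fields on $\Omega$ take values in $\mathbb R^3$; if $d=2$, fields do not depend on the third coordinate. Write $\langle\cdot,\cdot\rangle$ for the $L^2(\Omega)$ inner product, $\|\cdot\|$ for the $L^2(\Omega)$ norm and $\|v\|_{DC}^2=\|v\|^2+\|\nabla\cdot v\|^2+\|\nabla\times v\|^2$, with weak derivatives. Let $K_1\in\mathbb R$, $K_2,K_3>0$, $\kappa=K_2/K_3$, $\epsilon_0,\epsilon_\parallel,\epsilon_\perp>0$ and $\epsilon_a=\epsilon_\parallel-\epsilon_\perp$ be constants. Let the current Newton approximations be $n_k\in H(\mathrm{div};\Omega)\cap H(\mathrm{curl};\Omega)$, continuous on $\overline\Omega$, $\phi_k\in H^1(\Omega)$ and $\lambda_k\in L^2(\Omega)$; let $C_\phi=\sup_\Omega|\nabla\phi_k|$ (essential supremum) and $Z=I-(1-\kappa)\,n_k\otimes n_k$. If $\epsilon_a<0$, assume $|n_k|^2\le\beta$ on $\Omega$ for some $\beta<\epsilon_\perp/|\epsilon_a|$. **Forms.** With full Dirichlet boundary conditions,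 and omitting the common factor $2$, the second derivatives of the Lagrangian are given by $$\begin{aligned}\tilde a(u,v)={}&K_1\langle\nabla\cdot u,\nabla\cdot v\rangle+K_3\langle Z\,\nabla\times u,\nabla\times v\rangle+\int_\Omega\lambda_k\,u\cdot v\\&+(K_2-K_3)\big(\langle u\cdot\nabla\times v,\,n_k\cdot\nabla\times n_k\rangle+\langle n_k\cdot\nabla\times v,\,u\cdot\nabla\times n_k\rangle+\langle n_k\cdot\nabla\times n_k,\,v\cdot\nabla\times u\rangle\\&\qquad+\langle n_k\cdot\nabla\times u,\,v\cdot\nabla\times n_k\rangle+\langle u\cdot\nabla\times n_k,\,v\cdot\nabla\times n_k\rangle\big),\\ a(u,v)={}&\tilde a(u,v)-\epsilon_0\epsilon_a\langle u\cdot\nabla\phi_k,\,v\cdot\nabla\phi_k\rangle,\\ b_1(v,\psi)={}&-\epsilon_0\epsilon_a\langle n_k\cdot\nabla\phi_k,\,v\cdot\nabla\psi\rangle-\epsilon_0\epsilon_a\langle n_k\cdot\nabla\psi,\,v\cdot\nabla\phi_k\rangle,\\ b(v,\gamma)={}&\int_\Omega\gamma\,n_k\cdot v,\qquad c(\chi,\psi)=\epsilon_0\epsilon_\perp\langle\nabla\chi,\nabla\psi\rangle+\epsilon_0\epsilon_a\langle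 n_k\cdot\nabla\chi,\,n_k\cdot\nabla\psi\rangle.\end{aligned}$$ **Discrete spaces.** Let $\mathcal T_h$ be a finite subdivision of $\Omega$ into nondegenerate quadrilaterals (hexahedra if $d=3$), each the image of $[0,1]^d$ under an injective multilinear map $F_T$ with nonvanishing Jacobian: the cells cover $\overline\Omega$, and their interiors lie in $\Omega$ and are disjoint. Assume that $n_k$ does not vanish identically in the interior of any cell (which holds in particular if $|n_k|\ge\alpha>0$ on $\Omega$). Let $m\ge1$ and let - $Q_m$ be the space of continuous functions on $\overline\Omega$ that on each cell, in the reference coordinates, are polynomials of degree at most $m$ in each variable; - $V_h^b$ be the space of continuous fields on $\overline\Omega$ that vanish on $\partial\Omega$ and equal $a_Tb_Tn_k$ on each $T\in\mathcal T_h$, where $a_T\in\mathbb R$ and $b_T\circ F_T=\prod_i4\xi_i(1-\xi_i)$; - $V_h=\{v\in Q_m^3+V_h^b:\ v=0\text{ on }\partial\Omega\}$, $\Pi_h=P_0$ the piecewise constants on $\mathcal T_h$, and $\Phi_h\subset H^1_0(\Omega)$ any finite-dimensional subspace. For arbitrary bases of $V_h$, $\Phi_h$ and $\Pi_h$, let $A,B_1,B_2,\tilde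 C$ be the matrices of $a$ on $V_h$, $b_1$ on $V_h\times\Phi_h$, $b$ on $V_h\times\Pi_h$ and $c$ on $\Phi_h$, and let $$M=\begin{bmatrix}A&B_1&B_2\\B_1^T&-\tilde C&0\\B_2^T&0&0\end{bmatrix}.$$ **Theorem.** Let $\alpha_0>0$ be such that $\tilde a(v,v)\ge\alpha_0\|v\|_{DC}^2$ for all $v\in V_h$. If $\epsilon_a\le0$, or if $C_\phi<\infty$ and $\alpha_0-\epsilon_0\epsilon_aC_\phi^2>0$, then $M$ is invertible. -/

import Mathlib

open MeasureTheory
open scoped ContDiff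

namespace NematicFE

noncomputable section

/-- The space `ℝ^d` containing the domain (`d = 2` or `d = 3`). -/
abbrev E (d : ℕ) : Type := EuclideanSpace ℝ (Fin d)

/-- The space `ℝ³` of values of directors, gradients and curls. -/
abbrev V3 : Type := EuclideanSpace ℝ (Fin 3)

variable {d : ℕ}

/-! ### Classical differential operators

Fields take values in `ℝ³` whether the domain lies in `ℝ²` or `ℝ³`. On a two-dimensional domain
they do not depend on the third coordinate, so that the third partial derivative is zero. -/

/-- The partial derivative in the direction of the `j`-th coordinate, zero if `j ≥ d`. -/
def pd (j : Fin 3) (f : E d → ℝ) (x : E d) : ℝ :=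
  if h : (j : ℕ) < d then fderiv ℝ f x (EuclideanSpace.single ⟨j, h⟩ 1) else 0

def grad (f : E d → ℝ) (x : E d) : V3 :=
  !₂[pd 0 f x, pd 1 f x, pd 2 f x]

def divg (v : E d → V3) (x : E d) : ℝ :=
  pd 0 (fun y => v y 0) x + pd 1 (fun y => v y 1) x + pd 2 (fun y => v y 2) x

def curl (v : E d → V3) (x : E d) : V3 :=
  !₂[pd 1 (fun y => v y 2) x - pd 2 (fun y => v y 1) x,
     pd 2 (fun y => v y 0) x - pd 0 (fun y => v y 2) x,
     pd 0 (fun y => v y 1) x - pd 1 (fun y => v y 0) x]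

/-! ### Weak derivatives and Sobolev spaces on an open set `Ω` -/

/-- `C_c^∞(Ω; F)`. -/
def IsTest {F : Type*} [NormedAddCommGroup F] [NormedSpace ℝ F]
    (Ω : Set (E d)) (ψ : E d → F) : Prop :=
  ContDiff ℝ ∞ ψ ∧ HasCompactSupport ψ ∧ tsupport ψ ⊆ Ω

/-- `g ∈ L²(Ω)³` is the weak gradient of `u` on `Ω`. -/
def IsWeakGrad (Ω : Set (E d)) (u : E d → ℝ) (g : E d → V3) : Prop :=
  MemLp g 2 (volume.restrict Ω) ∧
    ∀ ψ : E d → V3, IsTest Ω ψ →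
      ∫ x in Ω, u x * divg ψ x = - ∫ x in Ω, inner ℝ (g x) (ψ x)

/-- `g ∈ L²(Ω)` is the weak divergence of `v` on `Ω`. -/
def IsWeakDiv (Ω : Set (E d)) (v : E d → V3) (g : E d → ℝ) : Prop :=
  MemLp g 2 (volume.restrict Ω) ∧
    ∀ ψ : E d → ℝ, IsTest Ω ψ →
      ∫ x in Ω, inner ℝ (v x) (grad ψ x) = - ∫ x in Ω, g x * ψ x

/-- `w ∈ L²(Ω)³` is the weak curl of `v` on `Ω`. -/
def IsWeakCurl (Ω : Set (E d)) (v : E d → V3) (w : E d → V3) : Prop :=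
  MemLp w 2 (volume.restrict Ω) ∧
    ∀ ψ : E d → V3, IsTest Ω ψ →
      ∫ x in Ω, inner ℝ (v x) (curl ψ x) = ∫ x in Ω, inner ℝ (w x) (ψ x)

/-- The Sobolev space `H¹(Ω)`. -/
def MemH1 (Ω : Set (E d)) (u : E d → ℝ) : Prop :=
  MemLp u 2 (volume.restrict Ω) ∧ ∃ g, IsWeakGrad Ω u g

/-- `H(div; Ω) ∩ H(curl; Ω)`. -/
def MemHDC (Ω : Set (E d)) (v : E d → V3) : Prop :=
  MemLp v 2 (volume.restrict Ω) ∧ (∃ g, IsWeakDiv Ω v g) ∧ ∃ w, IsWeakCurl Ω v w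

open Classical in
/-- The weak gradient in `L²(Ω)³` (unique almost everywhere on `Ω`), if there is one. -/
def weakGrad (Ω : Set (E d)) (u : E d → ℝ) : E d → V3 :=
  if h : ∃ g, IsWeakGrad Ω u g then h.choose else 0

open Classical in
/-- The weak divergence in `L²(Ω)` (unique almost everywhere on `Ω`), if there is one. -/
def weakDiv (Ω : Set (E d)) (v : E d → V3) : E d → ℝ :=
  if h : ∃ g, IsWeakDiv Ω v g then h.choose else 0

open Classical in
/-- The weak curl in `L²(Ω)³` (unique almost everywhere on `Ω`), if there is one. -/
def weakCurl (Ω : Set (E d)) (v : E d → V3) : E d → V3 :=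
  if h : ∃ w, IsWeakCurl Ω v w then h.choose else 0

/-- `H¹₀(Ω)`: the closure of `C_c^∞(Ω)` in `H¹(Ω)`. -/
def MemH10 (Ω : Set (E d)) (u : E d → ℝ) : Prop :=
  MemH1 Ω u ∧ ∀ ε : ENNReal, 0 < ε → ∃ ψ : E d → ℝ, IsTest Ω ψ ∧
    eLpNorm (fun x => u x - ψ x) 2 (volume.restrict Ω) ≤ ε ∧
    eLpNorm (fun x => weakGrad Ω u x - grad ψ x) 2 (volume.restrict Ω) ≤ ε

/-- The squared norm `‖v‖² + ‖∇ · v‖² + ‖∇ × v‖²` of `H(div; Ω) ∩ H(curl; Ω)`. -/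
def normDCsq (Ω : Set (E d)) (v : E d → V3) : ℝ :=
  (∫ x in Ω, ‖v x‖ ^ 2) + (∫ x in Ω, weakDiv Ω v x ^ 2) + ∫ x in Ω, ‖weakCurl Ω v x‖ ^ 2

/-! ### Subdivisions into quadrilaterals (hexahedra if `d = 3`) -/

/-- The closed reference cell `[0,1]^d`. -/
def refCube (d : ℕ) : Set (E d) := {ξ | ∀ i, ξ i ∈ Set.Icc (0 : ℝ) 1}

/-- The open reference cell `(0,1)^d`. -/
def refCubeOpen (d : ℕ) : Set (E d) := {ξ | ∀ i, ξ i ∈ Set.Ioo (0 : ℝ) 1}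

/-- The multilinear map (bilinear if `d = 2`) that sends the vertex `σ` of the reference cell to
`P σ`. Its image is the quadrilateral (hexahedron) with these vertices. -/
def refMap (P : (Fin d → Bool) → E d) (ξ : E d) : E d :=
  ∑ σ : Fin d → Bool, (∏ i, if σ i then ξ i else 1 - ξ i) • P σ

/-- A subdivision of `Ω` into finitely many nondegenerate quadrilaterals (hexahedra). -/
structure QuadMesh (d : ℕ) (Ω : Set (E d)) where
  numCells : ℕ
  vertex : Fin numCells → (Fin d → Bool) → E d
  injOn : ∀ T, Set.InjOn (refMap (vertex T)) (refCube d)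
  det_ne_zero : ∀ T, ∀ ξ ∈ refCube d, (fderiv ℝ (refMap (vertex T)) ξ).det ≠ 0
  interior_subset : ∀ T, refMap (vertex T) '' refCubeOpen d ⊆ Ω
  disjoint : ∀ T T', T ≠ T' →
    Disjoint (refMap (vertex T) '' refCubeOpen d) (refMap (vertex T') '' refCubeOpen d)
  cover : ⋃ T, refMap (vertex T) '' refCube d = closure Ω

namespace QuadMesh

variable {Ω : Set (E d)} (𝒯 : QuadMesh d Ω)

/-- The map of the reference cell onto the cell `T`. -/
def cellMap (T : Fin 𝒯.numCells) : E d → E d := refMap (𝒯.vertex T)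

/-- The interior of the cell `T`. -/
def openCell (T : Fin 𝒯.numCells) : Set (E d) := 𝒯.cellMap T '' refCubeOpen d

end QuadMesh

/-! ### Finite-element spaces -/

section Spaces

variable {Ω : Set (E d)} (𝒯 : QuadMesh d Ω)

/-- The scalar space `Q_m`: functions continuous on the closure of `Ω` that on every cell are
polynomials of degree at most `m` in each reference coordinate. Functions on the closure of `Ω`
are represented by functions that vanish outside of it. -/
def spaceQ (m : ℕ) : Submodule ℝ (E d → ℝ) where
  carrier := {f | ContinuousOn f (closure Ω) ∧ (∀ x ∉ closure Ω, f x = 0) ∧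
    ∀ T, ∃ p : MvPolynomial (Fin d) ℝ, (∀ i, p.degreeOf i ≤ m) ∧
      ∀ ξ ∈ refCube d, f (𝒯.cellMap T ξ) = MvPolynomial.eval (fun i => ξ i) p}
  zero_mem' := ⟨continuousOn_const, fun _ _ => rfl, fun _ => ⟨0, by simp, by simp⟩⟩
  add_mem' := by
    rintro f g ⟨hf, hf', hfp⟩ ⟨hg, hg', hgp⟩
    refine ⟨hf.add hg, fun x hx => by simp [hf' x hx, hg' x hx], fun T => ?_⟩
    obtain ⟨p, hp, hfp⟩ := hfp T
    obtain ⟨q, hq, hgq⟩ := hgp T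
    refine ⟨p + q, fun i => (MvPolynomial.degreeOf_add_le i p q).trans (max_le (hp i) (hq i)),
      fun ξ hξ => by simp [hfp ξ hξ, hgq ξ hξ]⟩
  smul_mem' := by
    rintro c f ⟨hf, hf', hfp⟩
    refine ⟨hf.const_smul c, fun x hx => by simp [hf' x hx], fun T => ?_⟩
    obtain ⟨p, hp, hfp⟩ := hfp T
    refine ⟨MvPolynomial.C c * p, fun i => (MvPolynomial.degreeOf_C_mul_le p i c).trans (hp i),
      fun ξ hξ => by simp [hfp ξ hξ]⟩

/-- `Q_m × Q_m × Q_m`. -/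
def spaceQ3 (m : ℕ) : Submodule ℝ (E d → V3) where
  carrier := {v | ∀ i, (fun x => v x i) ∈ spaceQ 𝒯 m}
  zero_mem' := fun _ => (spaceQ 𝒯 m).zero_mem
  add_mem' := fun hv hw i => (spaceQ 𝒯 m).add_mem (hv i) (hw i)
  smul_mem' := fun c _ hv i => (spaceQ 𝒯 m).smul_mem c (hv i)

/-- The bubble function `∏ 4 ξ_i (1 - ξ_i)` on the reference cell, biquadratic if `d = 2`. -/
def refBubble (ξ : E d) : ℝ := ∏ i, 4 * (ξ i * (1 - ξ i))

/-- The bubble space of the director field `n`: continuous fields that vanish outside `Ω`, and in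
particular on its boundary, and are equal to `a_T b_T n` on every cell `T`, with a constant `a_T`
and the bubble function `b_T` of `T`. -/
def spaceBubble (n : E d → V3) : Submodule ℝ (E d → V3) where
  carrier := {v | Continuous v ∧ (∀ x ∉ Ω, v x = 0) ∧
    ∀ T, ∃ a : ℝ, ∀ ξ ∈ refCube d,
      v (𝒯.cellMap T ξ) = (a * refBubble ξ) • n (𝒯.cellMap T ξ)}
  zero_mem' := ⟨continuous_const, fun _ _ => rfl, fun _ => ⟨0, by simp⟩⟩
  add_mem' := by
    rintro v w ⟨hv, hv', hva⟩ ⟨hw, hw', hwa⟩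
    refine ⟨hv.add hw, fun x hx => by simp [hv' x hx, hw' x hx], fun T => ?_⟩
    obtain ⟨a, ha⟩ := hva T
    obtain ⟨b, hb⟩ := hwa T
    exact ⟨a + b, fun ξ hξ => by rw [Pi.add_apply, ha ξ hξ, hb ξ hξ, ← add_smul, add_mul]⟩
  smul_mem' := by
    rintro c v ⟨hv, hv', hva⟩
    refine ⟨hv.const_smul c, fun x hx => by simp [hv' x hx], fun T => ?_⟩
    obtain ⟨a, ha⟩ := hva T
    exact ⟨c * a, fun ξ hξ => by rw [Pi.smul_apply, ha ξ hξ, smul_smul, mul_assoc]⟩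

/-- Fields that vanish on the boundary of `Ω`. -/
def zeroOnBoundary (Ω : Set (E d)) : Submodule ℝ (E d → V3) where
  carrier := {v | ∀ x ∈ frontier Ω, v x = 0}
  zero_mem' := fun _ _ => rfl
  add_mem' := fun hv hw x hx => by simp [hv x hx, hw x hx]
  smul_mem' := fun c v hv x hx => by simp [hv x hx]

/-- The space `V_h` of the director updates: the fields in the sum of `Q_m × Q_m × Q_m` and the
bubble space that vanish on the boundary of `Ω`. -/
def spaceV (m : ℕ) (n : E d → V3) : Submodule ℝ (E d → V3) :=
  (spaceQ3 𝒯 m ⊔ spaceBubble 𝒯 n) ⊓ zeroOnBoundary Ω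

/-- The space `P_0` of piecewise constants, represented by functions that are constant in the
interior of every cell and vanish elsewhere. -/
def spaceP0 : Submodule ℝ (E d → ℝ) :=
  Submodule.span ℝ (Set.range fun T => (𝒯.openCell T).indicator (fun _ => (1 : ℝ)))

end Spaces

/-! ### Bilinear forms of the Newton linearization -/

/-- The material constants: Frank elastic constants and dielectric permittivities. -/
structure Material where
  K1 : ℝ
  K2 : ℝ
  K3 : ℝ
  eps0 : ℝ
  epsPar : ℝ
  epsPerp : ℝ
  K2_pos : 0 < K2
  K3_pos : 0 < K3
  eps0_pos : 0 < eps0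
  epsPar_pos : 0 < epsPar
  epsPerp_pos : 0 < epsPerp

namespace Material

/-- The ratio `κ = K₂ / K₃`. -/
def kappa (μ : Material) : ℝ := μ.K2 / μ.K3

/-- The dielectric anisotropy `ε_a = ε_∥ - ε_⊥`. -/
def epsA (μ : Material) : ℝ := μ.epsPar - μ.epsPerp

end Material

/-- `Z(n) w`, where `Z(n) = I - (1 - κ) n ⊗ n`. -/
def applyZ (κ : ℝ) (n w : V3) : V3 := w - ((1 - κ) * inner ℝ n w) • n

section Forms

variable (μ : Material) (Ω : Set (E d)) (n : E d → V3) (φ lam : E d → ℝ)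

/-- The free elastic form `ã(u, v)` at the current director `n` and multiplier `lam`, under full
Dirichlet boundary conditions (no null Lagrangian) and without the common factor 2. -/
def formElastic (u v : E d → V3) : ℝ :=
  μ.K1 * (∫ x in Ω, weakDiv Ω u x * weakDiv Ω v x)
  + μ.K3 * (∫ x in Ω, inner ℝ (applyZ μ.kappa (n x) (weakCurl Ω u x)) (weakCurl Ω v x))
  + (μ.K2 - μ.K3) *
    ((∫ x in Ω, inner ℝ (u x) (weakCurl Ω v x) * inner ℝ (n x) (weakCurl Ω n x))
    + (∫ x in Ω, inner ℝ (n x) (weakCurl Ω v x) * inner ℝ (u x) (weakCurl Ω n x))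
    + (∫ x in Ω, inner ℝ (n x) (weakCurl Ω n x) * inner ℝ (v x) (weakCurl Ω u x))
    + (∫ x in Ω, inner ℝ (n x) (weakCurl Ω u x) * inner ℝ (v x) (weakCurl Ω n x))
    + (∫ x in Ω, inner ℝ (u x) (weakCurl Ω n x) * inner ℝ (v x) (weakCurl Ω n x)))
  + ∫ x in Ω, lam x * inner ℝ (u x) (v x)

/-- The form `a(u, v) = ã(u, v) - ε₀ ε_a ⟨u · ∇φ, v · ∇φ⟩`. -/
def formA (u v : E d → V3) : ℝ :=
  formElastic μ Ω n lam u v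
  - μ.eps0 * μ.epsA *
    ∫ x in Ω, inner ℝ (u x) (weakGrad Ω φ x) * inner ℝ (v x) (weakGrad Ω φ x)

/-- The mixed director-potential form. -/
def formB1 (v : E d → V3) (u : E d → ℝ) : ℝ :=
  - μ.eps0 * μ.epsA *
      (∫ x in Ω, inner ℝ (n x) (weakGrad Ω φ x) * inner ℝ (v x) (weakGrad Ω u x))
  - μ.eps0 * μ.epsA *
      (∫ x in Ω, inner ℝ (n x) (weakGrad Ω u x) * inner ℝ (v x) (weakGrad Ω φ x))

/-- The mixed director-multiplier form `b(v, γ) = ∫ γ (n · v)`. -/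
def formB2 (v : E d → V3) (γ : E d → ℝ) : ℝ :=
  ∫ x in Ω, γ x * inner ℝ (n x) (v x)

/-- The form `c(u, w) = ε₀ ε_⊥ ⟨∇u, ∇w⟩ + ε₀ ε_a ⟨n · ∇u, n · ∇w⟩`. -/
def formC (u w : E d → ℝ) : ℝ :=
  μ.eps0 * μ.epsPerp * (∫ x in Ω, inner ℝ (weakGrad Ω u x) (weakGrad Ω w x))
  + μ.eps0 * μ.epsA *
    ∫ x in Ω, inner ℝ (n x) (weakGrad Ω u x) * inner ℝ (n x) (weakGrad Ω w x)

/-- `C_φ`, the (essential) supremum of `|∇φ|` over `Ω`. -/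
def Cphi : ℝ := (eLpNorm (weakGrad Ω φ) ⊤ (volume.restrict Ω)).toReal

/-- The discretized Hessian
`[[A, B₁, B₂], [B₁ᵀ, -C̃, 0], [B₂ᵀ, 0, 0]]`
with respect to the director basis `v`, the potential basis `χ` and the multiplier basis `γ`. -/
def hessianMatrix {ι₁ ι₂ ι₃ : Type*}
    (v : ι₁ → E d → V3) (χ : ι₂ → E d → ℝ) (γ : ι₃ → E d → ℝ) :
    Matrix (ι₁ ⊕ (ι₂ ⊕ ι₃)) (ι₁ ⊕ (ι₂ ⊕ ι₃)) ℝ :=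
  let A : Matrix ι₁ ι₁ ℝ := Matrix.of fun i j => formA μ Ω n φ lam (v j) (v i)
  let B₁ : Matrix ι₁ ι₂ ℝ := Matrix.of fun i j => formB1 μ Ω n φ (v i) (χ j)
  let B₂ : Matrix ι₁ ι₃ ℝ := Matrix.of fun i j => formB2 Ω n (v i) (γ j)
  let C : Matrix ι₂ ι₂ ℝ := Matrix.of fun i j => formC μ Ω n (χ j) (χ i)
  Matrix.fromBlocks A (Matrix.fromCols B₁ B₂)
    (Matrix.fromRows B₁.transpose B₂.transpose) (Matrix.fromBlocks (-C) 0 0 0)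

end Forms

end

end NematicFE

open NematicFE

/-!
The matrix is that of a saddle point problem, and `isUnit_saddlePoint` is the algebra behind its
invertibility: a vector in the kernel represents fields `v`, `u`, `γ` with
`a(v, v) + c(u, u) = 0` and `b(v, γ) = 0`, so that `v = 0` and `u = 0` once the diagonal blocks are
positive definite, and then `b(w, γ) = 0` for all `w ∈ V_h`. The form `a` is positive definite by
the coercivity assumption and the bound on `∇φ` (`exists_formA_ge`); the form `c` controls `∇u`
(`exists_formC_ge`), hence `u` by the Poincaré inequality (`MemH10.ae_eq_zero`). Testing with the
bubble field `w = b_T n` of a cell gives `γ_T ∫ b_T |n|² = 0`, and hence `γ = 0`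
(`eq_zero_of_formB2_bubble_eq_zero`).

All this presupposes that the forms are bilinear on the discrete spaces. As they are defined through
weak derivatives that are zero by convention where they do not exist, one has to show that
`V_h ⊂ H(div; Ω) ∩ H(curl; Ω)` (`isRegular_of_mem_spaceV`). A function vanishing outside `Ω` that is
`C¹` in the reference coordinates of each cell is Lipschitz on each cell, because the cell maps have
Lipschitz inverses, and then globally, because the pieces are finitely many closed sets
(`QuadMesh.exists_lipschitzWith`). Each field of `V_h` is therefore a sum of products `β a` with a
Lipschitz function `β` that vanishes outside `Ω` and a field `a` that is constant or equal to `n`.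
Mollification shows that the weak divergence can be tested with Lipschitz functions
(`IsWeakDiv.integral_lineGrad`), and this gives the Leibniz rule for `β a`
(`IsWeakDiv.lipschitz_smul`). Curls and gradients reduce to divergences: the `i`-th component of
`∇ × v` is `-∇ · (e_i × v)` (`isWeakCurl_iff`), and that of `∇u` is `∇ · (u e_i)`
(`isWeakGrad_iff`).
-/

open Filter Set Topology
open scoped NNReal Convolution

namespace NematicFE

/-! ### Lipschitz functions glued from finitely many closed pieces -/

/-- A function with a uniform pointwise Lipschitz constant at every point is globally Lipschitz:
this is the mean value inequality along segments. -/
theorem lipschitzWith_of_eventually_dist_le {X Y : Type*} [NormedAddCommGroup X] [NormedSpace ℝ X]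
    [NormedAddCommGroup Y] {f : X → Y} {C : ℝ≥0}
    (h : ∀ x, ∀ᶠ y in 𝓝 x, dist (f y) (f x) ≤ C * dist y x) : LipschitzWith C f := by
  refine LipschitzWith.of_dist_le_mul fun x y => ?_
  have hcont : Continuous f := by
    refine continuous_iff_continuousAt.2 fun x => tendsto_iff_dist_tendsto_zero.2 ?_
    refine squeeze_zero' (Eventually.of_forall fun _ => dist_nonneg) (h x) ?_
    have : Continuous fun y => (C : ℝ) * dist y x := by fun_prop
    simpa using this.tendsto x
  set p : ℝ → X := fun t => y + t • (x - y) with hp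
  have hpc : Continuous p := by fun_prop
  have hpd : ∀ s t, dist (p s) (p t) = |s - t| * dist x y := fun s t => by
    simp only [hp, dist_eq_norm]
    rw [add_sub_add_left_eq_sub, ← sub_smul, norm_smul, Real.norm_eq_abs]
  have hB : ∀ t ∈ Icc (0 : ℝ) 1, ‖f (p t) - f (p 0)‖ ≤ C * dist x y * t := by
    refine image_le_of_liminf_slope_right_le_deriv_boundary (B' := fun _ => C * dist x y)
      (by fun_prop) (by simp) (by fun_prop)
      (fun t _ => by simpa using ((hasDerivAt_id t).const_mul (C * dist x y)).hasDerivWithinAt) ?_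
    intro t _ r hr
    have h1 : ∀ᶠ s in 𝓝[>] t, dist (f (p s)) (f (p t)) ≤ C * dist (p s) (p t) :=
      ((hpc.tendsto t).mono_left nhdsWithin_le_nhds).eventually (h (p t))
    refine Eventually.frequently ?_
    filter_upwards [h1, self_mem_nhdsWithin] with s hs hst
    have hst' : 0 < s - t := sub_pos.2 hst
    rw [slope_def_field, div_lt_iff₀ hst']
    rw [hpd, abs_of_pos hst', dist_eq_norm] at hs
    have : ‖f (p s) - f (p 0)‖ - ‖f (p t) - f (p 0)‖ ≤ ‖f (p s) - f (p t)‖ := by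
      simpa using norm_sub_norm_le (f (p s) - f (p 0)) (f (p t) - f (p 0))
    nlinarith
  have := hB 1 (by simp)
  simpa [hp, dist_eq_norm] using this

/-- A function that is Lipschitz on each of finitely many closed sets covering the space is
globally Lipschitz. -/
theorem exists_lipschitzWith_of_closed_cover {X Y ι : Type*} [NormedAddCommGroup X]
    [NormedSpace ℝ X] [NormedAddCommGroup Y] [Finite ι] {f : X → Y} {S : ι → Set X}
    (hS : ∀ i, IsClosed (S i)) (hcov : ∀ x, ∃ i, x ∈ S i)
    (hf : ∀ i, ∃ C, LipschitzOnWith C f (S i)) : ∃ C, LipschitzWith C f := by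
  cases nonempty_fintype ι
  choose C hC using hf
  refine ⟨∑ i, C i, lipschitzWith_of_eventually_dist_le fun x => ?_⟩
  -- near `x` only the pieces that contain `x` matter
  have h1 : ∀ᶠ y in 𝓝 x, ∀ i, y ∈ S i → x ∈ S i := by
    refine eventually_all.2 fun i => ?_
    by_cases hx : x ∈ S i
    · exact Eventually.of_forall fun _ _ => hx
    · filter_upwards [(hS i).isOpen_compl.mem_nhds hx] with y hy hyi using absurd hyi hy
  filter_upwards [h1] with y hy
  obtain ⟨i, hi⟩ := hcov y
  refine ((hC i).dist_le_mul y hi x (hy i hi)).trans ?_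
  gcongr
  exact Finset.single_le_sum (f := C) (fun _ _ => zero_le) (Finset.mem_univ i)

/-! ### The cells of the subdivision -/

/-- An injective `C¹` map with invertible derivatives on a compact set has a Lipschitz inverse. -/
theorem exists_antilipschitz_of_injOn {X : Type*} [NormedAddCommGroup X] [NormedSpace ℝ X]
    [FiniteDimensional ℝ X] {f : X → X} {K : Set X} (hK : IsCompact K) (hf : ContDiff ℝ 1 f)
    (hinj : InjOn f K) (hdet : ∀ x ∈ K, (fderiv ℝ f x).det ≠ 0) :
    ∃ C : ℝ≥0, ∀ x ∈ K, ∀ y ∈ K, dist x y ≤ C * dist (f x) (f y) := by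
  suffices H : ∃ C : ℝ≥0, ∀ p ∈ K ×ˢ K, dist p.1 p.2 ≤ C * dist (f p.1) (f p.2) by
    obtain ⟨C, hC⟩ := H
    exact ⟨C, fun x hx y hy => hC (x, y) ⟨hx, hy⟩⟩
  refine (hK.prod hK).induction_on
    (p := fun S => ∃ C : ℝ≥0, ∀ p ∈ S, dist p.1 p.2 ≤ C * dist (f p.1) (f p.2)) ⟨0, by simp⟩
    (fun s t hst ⟨C, hC⟩ => ⟨C, fun p hp => hC p (hst hp)⟩) ?_ ?_
  · rintro s t ⟨C, hC⟩ ⟨D, hD⟩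
    refine ⟨C + D, fun p hp => ?_⟩
    have h0 : (0 : ℝ) ≤ dist (f p.1) (f p.2) := dist_nonneg
    push_cast
    rcases hp with hp | hp
    · nlinarith [hC p hp, D.coe_nonneg]
    · nlinarith [hD p hp, C.coe_nonneg]
  · rintro ⟨x, y⟩ ⟨hx, hy⟩
    rcases eq_or_ne x y with rfl | hxy
    · -- near the diagonal the derivative controls the distances
      have hd : HasStrictFDerivAt f
          ((fderiv ℝ f x).toContinuousLinearEquivOfDetNeZero (hdet x hx) : X →L[ℝ] X) x := by
        rw [ContinuousLinearMap.coe_toContinuousLinearEquivOfDetNeZero]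
        exact hf.contDiffAt.hasStrictFDerivAt one_ne_zero
      obtain ⟨s, hs, hs'⟩ := hd.approximates_deriv_on_open_nhds
      obtain ⟨D, hD⟩ : ∃ D, AntilipschitzWith D (s.domRestrict f) := by
        rcases subsingleton_or_nontrivial X with h | h
        · exact ⟨_, hs'.2.antilipschitz (.inl h)⟩
        · exact ⟨_, hs'.2.antilipschitz (.inr (NNReal.half_lt_self (inv_pos.2
            (ContinuousLinearEquiv.nnnorm_symm_pos _)).ne'))⟩
      refine ⟨s ×ˢ s, mem_nhdsWithin_of_mem_nhds
        (prod_mem_nhds (hs'.1.mem_nhds hs) (hs'.1.mem_nhds hs)), D, fun p hp => ?_⟩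
      exact hD.le_mul_dist ⟨p.1, hp.1⟩ ⟨p.2, hp.2⟩
    · have hne : 0 < dist (f x) (f y) := dist_pos.2 fun h => hxy (hinj hx hy h)
      have hfc := hf.continuous
      have hc1 : Continuous fun p : X × X => dist (f p.1) (f p.2) := by fun_prop
      have hc2 : Continuous fun p : X × X => dist p.1 p.2 := by fun_prop
      refine ⟨{p | dist (f x) (f y) / 2 < dist (f p.1) (f p.2) ∧ dist p.1 p.2 < dist x y + 1},
        mem_nhdsWithin_of_mem_nhds (inter_mem
          (hc1.continuousAt.eventually (lt_mem_nhds (half_lt_self hne)))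
          (hc2.continuousAt.eventually (gt_mem_nhds (lt_add_one _)))),
        ((dist x y + 1) / (dist (f x) (f y) / 2)).toNNReal, ?_⟩
      rintro p ⟨h1, h2⟩
      refine h2.le.trans ?_
      rw [Real.coe_toNNReal _ (by positivity), div_mul_eq_mul_div, le_div_iff₀ (by positivity)]
      have : 0 ≤ dist x y + 1 := by positivity
      gcongr

variable {d : ℕ}

theorem isCompact_refCube : IsCompact (refCube d) := by
  have : refCube d = (EuclideanSpace.equiv (Fin d) ℝ).toHomeomorph ⁻¹'
      (Set.univ.pi fun _ => Icc (0 : ℝ) 1) := by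
    ext x
    exact ⟨fun h i _ => h i, fun h i => h i trivial⟩
  rw [this, Homeomorph.isCompact_preimage]
  exact isCompact_univ_pi fun _ => isCompact_Icc

theorem convex_refCube : Convex ℝ (refCube d) := by
  have : refCube d = (EuclideanSpace.equiv (Fin d) ℝ).toLinearMap ⁻¹'
      (Set.univ.pi fun _ => Icc (0 : ℝ) 1) := by
    ext x
    exact ⟨fun h i _ => h i, fun h i => h i trivial⟩
  rw [this]
  exact (convex_pi fun _ _ => convex_Icc 0 1).linear_preimage _

theorem isOpen_refCubeOpen : IsOpen (refCubeOpen d) := by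
  have : refCubeOpen d = (EuclideanSpace.equiv (Fin d) ℝ) ⁻¹'
      (Set.univ.pi fun _ => Ioo (0 : ℝ) 1) := by
    ext x
    exact ⟨fun h i _ => h i, fun h i => h i trivial⟩
  rw [this]
  exact (isOpen_set_pi finite_univ fun _ _ => isOpen_Ioo).preimage
    (EuclideanSpace.equiv (Fin d) ℝ).continuous

theorem refCubeOpen_subset_refCube : refCubeOpen d ⊆ refCube d :=
  fun _ h i => Ioo_subset_Icc_self (h i)

theorem refCube_subset_closure_refCubeOpen : refCube d ⊆ closure (refCubeOpen d) := by
  have : refCubeOpen d = (EuclideanSpace.equiv (Fin d) ℝ).toHomeomorph ⁻¹'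
      (Set.univ.pi fun _ => Ioo (0 : ℝ) 1) := by
    ext x
    exact ⟨fun h i _ => h i, fun h i => h i trivial⟩
  rw [this, ← Homeomorph.preimage_closure, closure_pi_set]
  simp only [closure_Ioo (zero_ne_one (α := ℝ))]
  exact fun x hx i _ => hx i

theorem contDiff_coord {k : WithTop ℕ∞} (i : Fin d) : ContDiff ℝ k fun ξ : E d => ξ i :=
  (EuclideanSpace.proj (𝕜 := ℝ) i).contDiff

theorem contDiff_refMap {k : WithTop ℕ∞} (P : (Fin d → Bool) → E d) :
    ContDiff ℝ k (refMap P) := by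
  unfold refMap
  refine ContDiff.sum fun σ _ => ContDiff.fun_smul (contDiff_prod fun i _ => ?_) contDiff_const
  split_ifs
  · exact contDiff_coord i
  · exact contDiff_const.sub (contDiff_coord i)

theorem contDiff_refBubble {k : WithTop ℕ∞} : ContDiff ℝ k (refBubble (d := d)) :=
  contDiff_prod fun i _ => contDiff_const.mul
    ((contDiff_coord i).mul (contDiff_const.sub (contDiff_coord i)))

theorem contDiff_mvPolynomial_eval {k : WithTop ℕ∞} (p : MvPolynomial (Fin d) ℝ) :
    ContDiff ℝ k fun ξ : E d => MvPolynomial.eval (fun i => ξ i) p := by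
  induction p using MvPolynomial.induction_on with
  | C a => simpa using contDiff_const
  | add p q hp hq => simpa using hp.add hq
  | mul_X p i hp => simpa using hp.mul (contDiff_coord i)

theorem refBubble_nonneg {ξ : E d} (h : ξ ∈ refCube d) : 0 ≤ refBubble ξ :=
  Finset.prod_nonneg fun i _ => mul_nonneg (by norm_num)
    (mul_nonneg (h i).1 (sub_nonneg.2 (h i).2))

theorem refBubble_pos {ξ : E d} (h : ξ ∈ refCubeOpen d) : 0 < refBubble ξ :=
  Finset.prod_pos fun i _ => mul_pos (by norm_num) (mul_pos (h i).1 (sub_pos.2 (h i).2))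

theorem refBubble_eq_zero {ξ : E d} (h : ξ ∈ refCube d) (h' : ξ ∉ refCubeOpen d) :
    refBubble ξ = 0 := by
  simp only [refCubeOpen, mem_ofPred_eq, not_forall] at h'
  obtain ⟨i, hi⟩ := h'
  refine Finset.prod_eq_zero (Finset.mem_univ i) ?_
  have hi' := h i
  simp only [mem_Ioo, not_and_or, not_lt] at hi
  rcases hi with hi | hi
  · rw [le_antisymm hi hi'.1]; ring
  · rw [le_antisymm hi'.2 hi]; ring

namespace QuadMesh

variable {Ω : Set (E d)} (𝒯 : QuadMesh d Ω)

theorem continuous_cellMap (T : Fin 𝒯.numCells) : Continuous (𝒯.cellMap T) :=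
  (contDiff_refMap (k := 0) _).continuous

theorem isClosed_cell (T : Fin 𝒯.numCells) : IsClosed (𝒯.cellMap T '' refCube d) :=
  (isCompact_refCube.image (𝒯.continuous_cellMap T)).isClosed

theorem openCell_subset (T : Fin 𝒯.numCells) : 𝒯.openCell T ⊆ Ω := 𝒯.interior_subset T

theorem openCell_subset_cell (T : Fin 𝒯.numCells) :
    𝒯.openCell T ⊆ 𝒯.cellMap T '' refCube d := image_mono refCubeOpen_subset_refCube

theorem isOpen_openCell (T : Fin 𝒯.numCells) : IsOpen (𝒯.openCell T) := by
  rw [isOpen_iff_mem_nhds]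
  rintro _ ⟨ξ, hξ, rfl⟩
  have hdet : (fderiv ℝ (𝒯.cellMap T) ξ).det ≠ 0 :=
    𝒯.det_ne_zero T ξ (refCubeOpen_subset_refCube hξ)
  have hd : HasStrictFDerivAt (𝒯.cellMap T)
      ((fderiv ℝ (𝒯.cellMap T) ξ).toContinuousLinearEquivOfDetNeZero hdet : E d →L[ℝ] E d) ξ := by
    rw [ContinuousLinearMap.coe_toContinuousLinearEquivOfDetNeZero]
    exact (contDiff_refMap (k := 1) _).contDiffAt.hasStrictFDerivAt one_ne_zero
  rw [← hd.map_nhds_eq_of_equiv]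
  exact image_mem_map (isOpen_refCubeOpen.mem_nhds hξ)

theorem mem_closure_iff (x : E d) : x ∈ closure Ω ↔ ∃ T, ∃ ξ ∈ refCube d, 𝒯.cellMap T ξ = x := by
  rw [← 𝒯.cover]; simp [cellMap]

/-- A function that is `C¹` in the coordinates of the reference cell is Lipschitz on the cell. -/
theorem exists_lipschitzOnWith_cell (T : Fin 𝒯.numCells) {g f : E d → ℝ} (hg : ContDiff ℝ 1 g)
    (hf : ∀ ξ ∈ refCube d, f (𝒯.cellMap T ξ) = g ξ) :
    ∃ C, LipschitzOnWith C f (𝒯.cellMap T '' refCube d) := by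
  obtain ⟨C, hC⟩ := exists_antilipschitz_of_injOn isCompact_refCube
    (contDiff_refMap (k := 1) (𝒯.vertex T)) (𝒯.injOn T) (𝒯.det_ne_zero T)
  obtain ⟨D, hD⟩ := hg.contDiffOn.exists_lipschitzOnWith one_ne_zero convex_refCube
    isCompact_refCube
  refine ⟨D * C, LipschitzOnWith.of_dist_le_mul ?_⟩
  rintro _ ⟨ξ, hξ, rfl⟩ _ ⟨η, hη, rfl⟩
  rw [hf ξ hξ, hf η hη]
  refine (hD.dist_le_mul ξ hξ η hη).trans ?_
  rw [NNReal.coe_mul, mul_assoc]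
  gcongr
  exact hC ξ hξ η hη

/-- A function that vanishes outside `Ω` and is `C¹` in the reference coordinates of every cell is
globally Lipschitz. -/
theorem exists_lipschitzWith (hΩ : IsOpen Ω) {f : E d → ℝ} (hf0 : ∀ x ∉ Ω, f x = 0)
    (hf : ∀ T, ∃ g : E d → ℝ, ContDiff ℝ 1 g ∧ ∀ ξ ∈ refCube d, f (𝒯.cellMap T ξ) = g ξ) :
    ∃ C, LipschitzWith C f := by
  refine exists_lipschitzWith_of_closed_cover (ι := Option (Fin 𝒯.numCells))
    (S := fun o => o.elim Ωᶜ fun T => 𝒯.cellMap T '' refCube d) ?_ ?_ ?_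
  · rintro (_ | T)
    exacts [hΩ.isClosed_compl, 𝒯.isClosed_cell T]
  · intro x
    by_cases hx : x ∈ Ω
    · obtain ⟨T, h⟩ := (𝒯.mem_closure_iff x).1 (subset_closure hx)
      exact ⟨some T, h⟩
    · exact ⟨none, hx⟩
  · rintro (_ | T)
    · exact ⟨0, LipschitzOnWith.of_dist_le_mul fun x hx y hy => by simp [hf0 x hx, hf0 y hy]⟩
    · obtain ⟨g, hg, hgf⟩ := hf T
      exact 𝒯.exists_lipschitzOnWith_cell T hg hgf

open Classical in
/-- The bubble function `b_T` of the cell `T`, extended by zero outside the interior of `T`. -/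
noncomputable def bubble (T : Fin 𝒯.numCells) (x : E d) : ℝ :=
  if h : x ∈ 𝒯.openCell T then refBubble h.choose else 0

variable {𝒯}

theorem bubble_of_notMem {T : Fin 𝒯.numCells} {x : E d} (h : x ∉ 𝒯.openCell T) :
    𝒯.bubble T x = 0 := dif_neg h

theorem bubble_cellMap {T : Fin 𝒯.numCells} {ξ : E d} (h : ξ ∈ refCube d) :
    𝒯.bubble T (𝒯.cellMap T ξ) = refBubble ξ := by
  by_cases h' : 𝒯.cellMap T ξ ∈ 𝒯.openCell T
  · rw [bubble, dif_pos h']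
    congr 1
    exact 𝒯.injOn T (refCubeOpen_subset_refCube h'.choose_spec.1) h h'.choose_spec.2
  · rw [bubble_of_notMem h', refBubble_eq_zero h fun h'' => h' ⟨ξ, h'', rfl⟩]

theorem bubble_cellMap_of_ne {T T' : Fin 𝒯.numCells} (hT : T' ≠ T) {ξ : E d} (h : ξ ∈ refCube d) :
    𝒯.bubble T (𝒯.cellMap T' ξ) = 0 := by
  refine bubble_of_notMem fun hmem => ?_
  -- an open set that meets the closed cell `T'` meets its interior
  obtain ⟨η, hη, hη'⟩ := _root_.mem_closure_iff.1 (refCube_subset_closure_refCubeOpen h) _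
    ((𝒯.isOpen_openCell T).preimage (𝒯.continuous_cellMap T')) hmem
  exact (𝒯.disjoint T' T hT).le_bot ⟨⟨η, hη', rfl⟩, hη⟩

theorem bubble_nonneg (T : Fin 𝒯.numCells) (x : E d) : 0 ≤ 𝒯.bubble T x := by
  by_cases h : x ∈ 𝒯.openCell T
  · obtain ⟨ξ, hξ, rfl⟩ := 𝒯.openCell_subset_cell T h
    rw [bubble_cellMap hξ]
    exact refBubble_nonneg hξ
  · rw [bubble_of_notMem h]

theorem bubble_pos {T : Fin 𝒯.numCells} {x : E d} (h : x ∈ 𝒯.openCell T) : 0 < 𝒯.bubble T x := by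
  obtain ⟨ξ, hξ, rfl⟩ := h
  rw [bubble_cellMap (refCubeOpen_subset_refCube hξ)]
  exact refBubble_pos hξ

theorem bubble_eq_zero_of_notMem {T : Fin 𝒯.numCells} {x : E d} (h : x ∉ Ω) : 𝒯.bubble T x = 0 :=
  bubble_of_notMem fun h' => h (𝒯.openCell_subset T h')

theorem exists_lipschitzWith_bubble (hΩ : IsOpen Ω) (T : Fin 𝒯.numCells) :
    ∃ C, LipschitzWith C (𝒯.bubble T) := by
  refine 𝒯.exists_lipschitzWith hΩ (fun x hx => bubble_eq_zero_of_notMem hx) fun T' => ?_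
  by_cases h : T' = T
  · subst h
    exact ⟨refBubble, contDiff_refBubble, fun ξ hξ => bubble_cellMap hξ⟩
  · exact ⟨fun _ => 0, contDiff_const, fun ξ hξ => bubble_cellMap_of_ne h hξ⟩

end QuadMesh

variable {Ω : Set (E d)}

/-! ### Lipschitz functions as test functions -/

/-- The direction of the `j`-th partial derivative, zero if `j ≥ d`. -/
noncomputable def dir (d : ℕ) (j : Fin 3) : E d :=
  if h : (j : ℕ) < d then EuclideanSpace.single ⟨j, h⟩ 1 else 0

theorem pd_eq_fderiv (j : Fin 3) (f : E d → ℝ) (x : E d) : pd j f x = fderiv ℝ f x (dir d j) := by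
  unfold pd dir; split_ifs <;> simp

theorem pd_eq_lineDeriv (j : Fin 3) {f : E d → ℝ} {x : E d} (h : DifferentiableAt ℝ f x) :
    pd j f x = lineDeriv ℝ f x (dir d j) := by
  rw [pd_eq_fderiv, h.lineDeriv_eq_fderiv]

theorem norm_dir_le (j : Fin 3) : ‖dir d j‖ ≤ 1 := by
  unfold dir; split_ifs <;> simp

/-- The vector of the partial derivatives as line derivatives; for a Lipschitz function it is the
gradient almost everywhere. -/
noncomputable def lineGrad (f : E d → ℝ) (x : E d) : V3 :=
  !₂[lineDeriv ℝ f x (dir d 0), lineDeriv ℝ f x (dir d 1), lineDeriv ℝ f x (dir d 2)]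

theorem lineGrad_apply (f : E d → ℝ) (x : E d) (j : Fin 3) :
    lineGrad f x j = lineDeriv ℝ f x (dir d j) := by
  fin_cases j <;> rfl

theorem grad_apply (f : E d → ℝ) (x : E d) (j : Fin 3) : grad f x j = pd j f x := by
  fin_cases j <;> rfl

theorem norm_le_of_coord_le {v : V3} {M : ℝ} (hM : 0 ≤ M) (h : ∀ i, |v i| ≤ M) :
    ‖v‖ ≤ 2 * M := by
  rw [EuclideanSpace.norm_eq, Real.sqrt_le_iff]
  refine ⟨by positivity, ?_⟩
  simp only [Fin.sum_univ_three, Real.norm_eq_abs]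
  nlinarith [h 0, h 1, h 2, abs_nonneg (v 0), abs_nonneg (v 1), abs_nonneg (v 2)]

theorem inner_V3 (a b : V3) : inner ℝ a b = a 0 * b 0 + a 1 * b 1 + a 2 * b 2 := by
  simp [PiLp.inner_apply, Fin.sum_univ_three]; ring

theorem norm_lineGrad_le {f : E d → ℝ} {C : ℝ≥0} (hf : LipschitzWith C f) (x : E d) :
    ‖lineGrad f x‖ ≤ 2 * C := by
  refine norm_le_of_coord_le C.coe_nonneg fun j => ?_
  rw [lineGrad_apply, ← Real.norm_eq_abs]
  refine (norm_lineDeriv_le_of_lipschitz ℝ hf).trans ?_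
  nlinarith [norm_dir_le (d := d) j, C.coe_nonneg]

theorem tendsto_V3 {ι : Type*} {l : Filter ι} {f : ι → V3} {a : V3}
    (h : ∀ j, Tendsto (fun k => f k j) l (𝓝 (a j))) : Tendsto f l (𝓝 a) := by
  have := ((PiLp.continuous_toLp 2 fun _ : Fin 3 => ℝ).tendsto _).comp (tendsto_pi_nhds.2 h)
  exact this

theorem measurable_V3 {α : Type*} [MeasurableSpace α] {f : α → V3}
    (h : ∀ j, Measurable fun x => f x j) : Measurable f :=
  (MeasurableEquiv.toLp 2 (Fin 3 → ℝ)).measurable.comp (measurable_pi_iff.2 h)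

theorem measurable_lineGrad {f : E d → ℝ} (hf : Continuous f) : Measurable (lineGrad f) :=
  measurable_V3 fun j => by
    simpa only [lineGrad_apply] using measurable_lineDeriv hf

theorem abs_convolution_le (ρ : ContDiffBump (0 : E d)) {h : E d → ℝ} {B : ℝ}
    (hm : AEStronglyMeasurable h volume) (hB : ∀ x, |h x| ≤ B) (x : E d) :
    |(ρ.normed volume ⋆[ContinuousLinearMap.lsmul ℝ ℝ, volume] h) x| ≤ 3 * B := by
  have h1 := ρ.dist_normed_convolution_le (μ := volume) (x₀ := x) (ε := 2 * B) hm fun y _ => by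
    rw [Real.dist_eq]
    linarith [abs_sub (h y) (h x), hB x, hB y]
  rw [Real.dist_eq] at h1
  have := abs_sub_abs_le_abs_sub
    ((ρ.normed volume ⋆[ContinuousLinearMap.lsmul ℝ ℝ, volume] h) x) (h x)
  linarith [hB x]

/-- The derivative of a mollified Lipschitz function is its mollified derivative. -/
theorem fderiv_convolution_eq (ρ : ContDiffBump (0 : E d)) {g : E d → ℝ} {C : ℝ≥0}
    (hg : LipschitzWith C g) (e x : E d)
    (hd : DifferentiableAt ℝ
      (ρ.normed volume ⋆[ContinuousLinearMap.lsmul ℝ ℝ, volume] g) x) :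
    fderiv ℝ (ρ.normed volume ⋆[ContinuousLinearMap.lsmul ℝ ℝ, volume] g) x e =
      (ρ.normed volume ⋆[ContinuousLinearMap.lsmul ℝ ℝ, volume] fun y => lineDeriv ℝ g y e) x := by
  have hρc : Continuous (ρ.normed (volume : Measure (E d))) := ρ.continuous_normed
  have hρs : HasCompactSupport (ρ.normed (volume : Measure (E d))) := ρ.hasCompactSupport_normed
  have hgc := hg.continuous
  have key := hasDerivAt_integral_of_dominated_loc_of_lip (𝕜 := ℝ) (μ := (volume : Measure (E d)))
    (F := fun (s : ℝ) t => ρ.normed volume t * g (x + s • e - t)) (x₀ := (0 : ℝ)) (s := univ)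
    (F' := fun t => ρ.normed volume t * lineDeriv ℝ g (x - t) e)
    (bound := fun t => ρ.normed volume t * (C * ‖e‖)) univ_mem
    (Eventually.of_forall fun s => Continuous.aestronglyMeasurable (by fun_prop))
    (Continuous.integrable_of_hasCompactSupport (by fun_prop) hρs.mul_right)
    (hρc.aestronglyMeasurable.mul ((measurable_lineDeriv hgc).comp
      (measurable_const.sub measurable_id)).aestronglyMeasurable)
    (Eventually.of_forall fun t => ?_)
    ((hρc.integrable_of_hasCompactSupport hρs).mul_const _) ?_
  · have h1 := (hd.hasFDerivAt.hasLineDerivAt e)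
    unfold HasLineDerivAt at h1
    have h2 := h1.unique (by simpa [convolution_def] using key.2)
    simpa [convolution_def] using h2
  · refine LipschitzOnWith.of_dist_le_mul fun s _ s' _ => ?_
    have h0 := ρ.nonneg_normed (μ := (volume : Measure (E d))) t
    rw [Real.coe_nnabs, abs_of_nonneg (by positivity), Real.dist_eq, ← mul_sub, abs_mul,
      abs_of_nonneg h0, mul_assoc]
    refine mul_le_mul_of_nonneg_left ?_ h0
    rw [← Real.dist_eq]
    refine (hg.dist_le_mul _ _).trans (le_of_eq ?_)
    rw [dist_eq_norm, sub_sub_sub_cancel_right, add_sub_add_left_eq_sub, ← sub_smul, norm_smul,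
      Real.dist_eq, Real.norm_eq_abs]
    ring
  · have h1 := (Measure.measurePreserving_sub_left (volume : Measure (E d)) x).quasiMeasurePreserving.ae
      (hg.ae_lineDifferentiableAt e)
    filter_upwards [h1] with t ht
    have h2 : HasDerivAt (fun s : ℝ => g (x - t + s • e)) (lineDeriv ℝ g (x - t) e) 0 :=
      ht.hasLineDerivAt
    have h3 := h2.const_mul (ρ.normed volume t)
    refine h3.congr_of_eventuallyEq (Eventually.of_forall fun s => ?_)
    simp only [sub_add_eq_add_sub]

/-- A compactly supported Lipschitz function is approximated by test functions, with bounded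
pointwise convergence of the functions and (almost everywhere) of their gradients. -/
theorem exists_test_approx (hΩ : IsOpen Ω) {g : E d → ℝ} {C : ℝ≥0} (hg : LipschitzWith C g)
    (hc : HasCompactSupport g) (hs : tsupport g ⊆ Ω) :
    ∃ (ψ : ℕ → E d → ℝ) (M : ℝ), (∀ k, IsTest Ω (ψ k)) ∧ (∀ k x, |ψ k x| ≤ M) ∧
      (∀ x, Tendsto (fun k => ψ k x) atTop (𝓝 (g x))) ∧ (∀ k x, ‖grad (ψ k) x‖ ≤ M) ∧
      ∀ᵐ x, Tendsto (fun k => grad (ψ k) x) atTop (𝓝 (lineGrad g x)) := by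
  obtain ⟨δ, hδ, hδΩ⟩ := hc.isCompact.exists_cthickening_subset_open hΩ hs
  let ρ : ℕ → ContDiffBump (0 : E d) := fun k =>
    ⟨δ / (k + 2) / 2, δ / (k + 2), by positivity, half_lt_self (by positivity)⟩
  have hρ : Tendsto (fun k => (ρ k).rOut) atTop (𝓝 0) := by
    have h := (tendsto_const_div_atTop_nhds_zero_nat δ).comp (tendsto_add_atTop_nat 2)
    refine h.congr fun k => ?_
    simp [ρ]
  have hρ2 : ∀ᶠ k in atTop, (ρ k).rOut ≤ 2 * (ρ k).rIn :=
    Eventually.of_forall fun k => by simp only [ρ]; linarith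
  have hρδ : ∀ k, (ρ k).rOut ≤ δ := fun k => by
    refine div_le_self hδ.le ?_
    have : (0 : ℝ) ≤ k := k.cast_nonneg
    linarith
  have hgc := hg.continuous
  obtain ⟨B, hB⟩ := hc.exists_bound_of_continuous hgc
  have hgl : LocallyIntegrable g volume := hgc.locallyIntegrable
  let ψ : ℕ → E d → ℝ := fun k =>
    (ρ k).normed volume ⋆[ContinuousLinearMap.lsmul ℝ ℝ, volume] g
  have hψs : ∀ k, ContDiff ℝ ∞ (ψ k) := fun k =>
    (ρ k).hasCompactSupport_normed.contDiff_convolution_left _ (ρ k).contDiff_normed hgl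
  have hψd : ∀ k x, DifferentiableAt ℝ (ψ k) x := fun k x =>
    (hψs k).differentiable (by simp) x
  have hpd : ∀ k x j, pd j (ψ k) x = ((ρ k).normed volume ⋆[ContinuousLinearMap.lsmul ℝ ℝ, volume]
      fun y => lineDeriv ℝ g y (dir d j)) x := fun k x j => by
    rw [pd_eq_fderiv]
    exact fderiv_convolution_eq (ρ k) hg _ x (hψd k x)
  have hB0 : 0 ≤ B := (norm_nonneg _).trans (hB 0)
  refine ⟨ψ, 3 * B + 2 * (3 * C), fun k => ⟨hψs k, ?_, ?_⟩, fun k x => ?_, fun x => ?_,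
    fun k x => ?_, ?_⟩
  · exact (ρ k).hasCompactSupport_normed.convolution _ hc
  · refine (closure_minimal ((support_convolution_subset _).trans ?_)
      Metric.isClosed_cthickening).trans hδΩ
    rw [ContDiffBump.support_normed_eq]
    rintro _ ⟨y, hy, z, hz, rfl⟩
    refine Metric.mem_cthickening_of_dist_le _ z _ _ (subset_tsupport g hz) ?_
    simp only [Metric.mem_ball, dist_zero_right] at hy
    simpa using hy.le.trans (hρδ k)
  · have := abs_convolution_le (ρ k) hgc.aestronglyMeasurable hB x
    have hC := C.coe_nonneg
    linarith
  · exact ContDiffBump.convolution_tendsto_right_of_continuous hρ hgc x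
  · have : ∀ j, |grad (ψ k) x j| ≤ 3 * C := fun j => by
      rw [grad_apply, hpd]
      refine abs_convolution_le (ρ k) (measurable_lineDeriv hgc).aestronglyMeasurable
        (fun y => ?_) x
      refine (norm_lineDeriv_le_of_lipschitz ℝ hg).trans ?_
      nlinarith [norm_dir_le (d := d) j, C.coe_nonneg]
    have := norm_le_of_coord_le (by positivity) this
    linarith
  · have h1 : ∀ᵐ x : E d, ∀ j, Tendsto (fun k => pd j (ψ k) x) atTop
        (𝓝 (lineDeriv ℝ g x (dir d j))) := by
      refine ae_all_iff.2 fun j => ?_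
      simp only [hpd]
      exact ContDiffBump.ae_convolution_tendsto_right_of_locallyIntegrable hρ hρ2
        (hg.locallyIntegrable_lineDeriv _)
    filter_upwards [h1] with x hx
    refine tendsto_V3 fun j => ?_
    simpa only [grad_apply, lineGrad_apply] using hx j

theorem integrable_inner_of_memLp {α F : Type*} [MeasurableSpace α] {ν : Measure α}
    [NormedAddCommGroup F] [InnerProductSpace ℝ F] {f g : α → F} (hf : MemLp f 2 ν)
    (hg : MemLp g 2 ν) : Integrable (fun x => inner ℝ (f x) (g x)) ν := by
  refine (hf.norm.integrable_mul hg.norm).mono (hf.1.inner hg.1) (Eventually.of_forall fun x => ?_)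
  simpa using abs_real_inner_le_norm (f x) (g x)

/-- The weak divergence can be tested with compactly supported Lipschitz functions. -/
theorem IsWeakDiv.integral_lineGrad (hΩ : IsOpen Ω) (hΩb : Bornology.IsBounded Ω) {a : E d → V3}
    {w : E d → ℝ} (ha : MemLp a 2 (volume.restrict Ω)) (h : IsWeakDiv Ω a w) {g : E d → ℝ}
    {C : ℝ≥0} (hg : LipschitzWith C g) (hc : HasCompactSupport g) (hs : tsupport g ⊆ Ω) :
    ∫ x in Ω, inner ℝ (a x) (lineGrad g x) = - ∫ x in Ω, w x * g x := by
  have : IsFiniteMeasure (volume.restrict Ω) :=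
    ⟨by simpa using hΩb.measure_lt_top⟩
  obtain ⟨ψ, M, hψ, hψM, hψg, hgM, hgg⟩ := exists_test_approx hΩ hg hc hs
  have hψc : ∀ k, Continuous (ψ k) := fun k => (hψ k).1.continuous
  have hgm : ∀ k, Measurable (grad (ψ k)) := fun k => measurable_V3 fun j => by
    simp only [grad_apply, pd_eq_fderiv]
    exact measurable_fderiv_apply_const ℝ (ψ k) _
  have hai : Integrable a (volume.restrict Ω) := ha.integrable (by norm_num)
  have hwi : Integrable w (volume.restrict Ω) := h.1.integrable (by norm_num)
  have h1 : Tendsto (fun k => ∫ x in Ω, inner ℝ (a x) (grad (ψ k) x)) atTop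
      (𝓝 (∫ x in Ω, inner ℝ (a x) (lineGrad g x))) := by
    refine tendsto_integral_of_dominated_convergence (fun x => ‖a x‖ * M)
      (fun k => ha.1.inner (hgm k).aestronglyMeasurable) (hai.norm.mul_const M)
      (fun k => Eventually.of_forall fun x => ?_) ?_
    · exact (norm_inner_le_norm _ _).trans (by gcongr; exact hgM k x)
    · filter_upwards [ae_restrict_of_ae hgg] with x hx using tendsto_const_nhds.inner hx
  have h2 : Tendsto (fun k => - ∫ x in Ω, w x * ψ k x) atTop (𝓝 (- ∫ x in Ω, w x * g x)) := by
    refine (tendsto_integral_of_dominated_convergence (fun x => ‖w x‖ * M)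
      (fun k => h.1.1.mul (hψc k).aestronglyMeasurable) (hwi.norm.mul_const M)
      (fun k => Eventually.of_forall fun x => ?_) ?_).neg
    · rw [Pi.mul_apply, norm_mul]; gcongr; exact hψM k x
    · exact Eventually.of_forall fun x => (hψg x).const_mul _
  refine tendsto_nhds_unique h1 (h2.congr fun k => (h.2 (ψ k) (hψ k)).symm)

/-- The Leibniz rule `∇ · (β a) = β ∇ · a + a · ∇β` for a bounded Lipschitz factor. -/
theorem IsWeakDiv.lipschitz_smul (hΩ : IsOpen Ω) (hΩb : Bornology.IsBounded Ω) {a : E d → V3}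
    {w : E d → ℝ} (ha : MemLp a 2 (volume.restrict Ω)) (h : IsWeakDiv Ω a w) {β : E d → ℝ}
    {C : ℝ≥0} (hβ : LipschitzWith C β) {B : ℝ} (hB : ∀ x, |β x| ≤ B) :
    IsWeakDiv Ω (fun x => β x • a x) (fun x => β x * w x + inner ℝ (a x) (lineGrad β x)) := by
  have hβm := hβ.continuous.aestronglyMeasurable (μ := volume.restrict Ω)
  have hGm := (measurable_lineGrad hβ.continuous).aestronglyMeasurable (μ := volume.restrict Ω)
  have m1 : MemLp (fun x => β x * w x) 2 (volume.restrict Ω) :=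
    h.1.of_le_mul (c := B) (hβm.mul h.1.1) (Eventually.of_forall fun x => by
      rw [norm_mul]; gcongr; exact hB x)
  have m2 : MemLp (fun x => inner ℝ (a x) (lineGrad β x)) 2 (volume.restrict Ω) :=
    ha.of_le_mul (c := 2 * C) (ha.1.inner hGm) (Eventually.of_forall fun x => by
      refine (norm_inner_le_norm _ _).trans ?_
      rw [mul_comm]; gcongr; exact norm_lineGrad_le hβ x)
  refine ⟨m1.add m2, fun ψ hψ => ?_⟩
  obtain ⟨hψ1, hψ2, hψ3⟩ := hψ
  obtain ⟨D, hD⟩ := hψ1.lipschitzWith_of_hasCompactSupport hψ2 (by simp)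
  obtain ⟨B', hB'⟩ := hψ2.exists_bound_of_continuous hψ1.continuous
  have hψd : ∀ x, DifferentiableAt ℝ ψ x := fun x => hψ1.differentiable (by simp) x
  have hLip : LipschitzWith (B.toNNReal * D + B'.toNNReal * C) (fun x => β x * ψ x) := by
    refine LipschitzWith.of_dist_le_mul fun x y => ?_
    have e : β x * ψ x - β y * ψ y = β x * (ψ x - ψ y) + ψ y * (β x - β y) := by ring
    have hB0 : 0 ≤ B := (abs_nonneg _).trans (hB 0)
    have hB0' : 0 ≤ B' := (norm_nonneg _).trans (hB' 0)
    rw [Real.dist_eq, e]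
    refine (abs_add_le _ _).trans ?_
    rw [abs_mul, abs_mul, ← Real.dist_eq, ← Real.dist_eq]
    push_cast
    rw [Real.coe_toNNReal _ hB0, Real.coe_toNNReal _ hB0', add_mul, mul_assoc, mul_assoc]
    have h1 := hD.dist_le_mul x y
    have h2 := hβ.dist_le_mul x y
    have h3 := hB x
    have h4 : |ψ y| ≤ B' := hB' y
    gcongr
  have hsupp : tsupport (fun x => β x * ψ x) ⊆ tsupport ψ := tsupport_mul_subset_right
  have key := h.integral_lineGrad hΩ hΩb ha hLip hψ2.mul_left (hsupp.trans hψ3)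
  have hrule : ∀ᵐ x : E d, lineGrad (fun x => β x * ψ x) x = β x • grad ψ x + ψ x • lineGrad β x := by
    have : ∀ᵐ x : E d, ∀ j, LineDifferentiableAt ℝ β x (dir d j) :=
      ae_all_iff.2 fun j => hβ.ae_lineDifferentiableAt _
    filter_upwards [this] with x hx
    ext j
    have h1 : HasDerivAt (fun s : ℝ => β (x + s • dir d j)) (lineDeriv ℝ β x (dir d j)) 0 :=
      (hx j).hasLineDerivAt
    have h2 : HasDerivAt (fun s : ℝ => ψ (x + s • dir d j)) (lineDeriv ℝ ψ x (dir d j)) 0 :=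
      (hψd x).lineDifferentiableAt.hasLineDerivAt
    have h3 : HasLineDerivAt ℝ (fun x => β x * ψ x) _ x (dir d j) := h1.fun_mul h2
    simp only [PiLp.add_apply, PiLp.smul_apply, lineGrad_apply, grad_apply, smul_eq_mul,
      h3.lineDeriv, pd_eq_lineDeriv j (hψd x), zero_smul, add_zero]
    ring
  have hψ0 := hψ1.continuous.aestronglyMeasurable (μ := volume.restrict Ω)
  have i1 : Integrable (fun x => β x * w x * ψ x) (volume.restrict Ω) := by
    have : IsFiniteMeasure (volume.restrict Ω) := ⟨by simpa using hΩb.measure_lt_top⟩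
    exact (m1.integrable (by norm_num)).mul_bdd (c := B') hψ0 (Eventually.of_forall hB')
  have i2 : Integrable (fun x => inner ℝ (a x) (lineGrad β x) * ψ x) (volume.restrict Ω) := by
    have : IsFiniteMeasure (volume.restrict Ω) := ⟨by simpa using hΩb.measure_lt_top⟩
    exact (m2.integrable (by norm_num)).mul_bdd (c := B') hψ0 (Eventually.of_forall hB')
  have i3 : Integrable (fun x => inner ℝ (a x) (lineGrad (fun x => β x * ψ x) x))
      (volume.restrict Ω) := by
    have : IsFiniteMeasure (volume.restrict Ω) := ⟨by simpa using hΩb.measure_lt_top⟩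
    have hm := (measurable_lineGrad hLip.continuous).aestronglyMeasurable (μ := volume.restrict Ω)
    refine ((ha.integrable (by norm_num)).norm.mul_const
      (2 * ((B.toNNReal * D + B'.toNNReal * C : ℝ≥0) : ℝ))).mono (ha.1.inner hm)
      (Eventually.of_forall fun x => ?_)
    rw [norm_mul, norm_norm]
    refine (norm_inner_le_norm _ _).trans ?_
    gcongr
    exact (norm_lineGrad_le hLip x).trans (le_abs_self _)
  have e1 : ∫ x in Ω, inner ℝ (β x • a x) (grad ψ x) =
      ∫ x in Ω, (inner ℝ (a x) (lineGrad (fun x => β x * ψ x) x) -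
        inner ℝ (a x) (lineGrad β x) * ψ x) := by
    refine integral_congr_ae ?_
    filter_upwards [ae_restrict_of_ae hrule] with x hx
    rw [hx, inner_add_right, inner_smul_right, inner_smul_right, real_inner_smul_left]
    ring
  rw [e1, integral_sub i3 i2, key]
  have e2 : ∫ x in Ω, (β x * w x + inner ℝ (a x) (lineGrad β x)) * ψ x =
      (∫ x in Ω, β x * w x * ψ x) + ∫ x in Ω, inner ℝ (a x) (lineGrad β x) * ψ x := by
    rw [← integral_add i1 i2]
    congr 1 with x
    ring
  rw [e2, neg_add, sub_eq_add_neg]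
  congr 3 with x
  ring

/-! ### Weak divergence, curl and gradient -/

theorem isFiniteMeasure_restrict (hΩb : Bornology.IsBounded Ω) :
    IsFiniteMeasure (volume.restrict Ω) :=
  ⟨by simpa using hΩb.measure_lt_top⟩

theorem integrable_mul_of_memLp {α : Type*} [MeasurableSpace α] {ν : Measure α} {f g : α → ℝ}
    (hf : MemLp f 2 ν) (hg : MemLp g 2 ν) : Integrable (fun x => f x * g x) ν :=
  hf.integrable_mul hg

theorem integral_add_three {α : Type*} [MeasurableSpace α] {ν : Measure α} {f g h : α → ℝ}
    (hf : Integrable f ν) (hg : Integrable g ν) (hh : Integrable h ν) :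
    ∫ x, (f x + g x + h x) ∂ν = ∫ x, f x ∂ν + ∫ x, g x ∂ν + ∫ x, h x ∂ν := by
  rw [integral_add (f := fun x => f x + g x) (hf.add hg) hh, integral_add hf hg]

section Test

variable {ψ : E d → ℝ}

theorem IsTest.memLp (hψ : IsTest Ω ψ) : MemLp ψ 2 (volume.restrict Ω) :=
  hψ.1.continuous.memLp_of_hasCompactSupport hψ.2.1

theorem IsTest.continuous_pd (hψ : IsTest Ω ψ) (j : Fin 3) : Continuous (pd j ψ) := by
  simp_rw [funext (pd_eq_fderiv j ψ)]
  exact (hψ.1.continuous_fderiv (by simp)).clm_apply continuous_const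

theorem IsTest.pd_eq_zero (hψ : IsTest Ω ψ) (j : Fin 3) {x : E d} (hx : x ∉ Ω) : pd j ψ x = 0 := by
  have : x ∉ tsupport (fderiv ℝ ψ) := fun h => hx (hψ.2.2 (tsupport_fderiv_subset ℝ h))
  rw [pd_eq_fderiv, image_eq_zero_of_notMem_tsupport this]; rfl

theorem IsTest.hasCompactSupport_pd (hψ : IsTest Ω ψ) (j : Fin 3) : HasCompactSupport (pd j ψ) := by
  simp_rw [funext (pd_eq_fderiv j ψ)]
  exact hψ.2.1.fderiv_apply ℝ _

theorem IsTest.memLp_grad (hψ : IsTest Ω ψ) : MemLp (grad ψ) 2 (volume.restrict Ω) :=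
  MemLp.of_eval_piLp fun j => by
    simp only [grad_apply]
    exact (hψ.continuous_pd j).memLp_of_hasCompactSupport (hψ.hasCompactSupport_pd j)

theorem IsTest.integral_pd (hψ : IsTest Ω ψ) (j : Fin 3) : ∫ x in Ω, pd j ψ x = 0 := by
  rw [setIntegral_eq_integral_of_forall_compl_eq_zero fun x hx => hψ.pd_eq_zero j hx]
  obtain ⟨D, hD⟩ := hψ.1.lipschitzWith_of_hasCompactSupport hψ.2.1 (by simp)
  have h := LipschitzWith.integral_lineDeriv_mul_eq (μ := volume)
    (LipschitzWith.const (1 : ℝ) : LipschitzWith 0 fun _ : E d => (1 : ℝ)) hD hψ.2.1 (-dir d j)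
  have hd : ∀ x, DifferentiableAt ℝ ψ x := fun x => hψ.1.differentiable (by simp) x
  have h0 : ∀ x, lineDeriv ℝ (fun _ : E d => (1 : ℝ)) x (-dir d j) = 0 := fun x => by
    simp [lineDeriv]
  simp only [h0, zero_mul, integral_zero, neg_neg, mul_one] at h
  rw [h]
  exact integral_congr_ae (Eventually.of_forall fun x => pd_eq_lineDeriv j (hd x))

theorem IsTest.smul_single (hψ : IsTest Ω ψ) (i : Fin 3) :
    IsTest Ω (fun x => ψ x • (EuclideanSpace.single i 1 : V3)) :=
  ⟨hψ.1.smul contDiff_const, hψ.2.1.smul_right, (tsupport_smul_subset_left _ _).trans hψ.2.2⟩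

end Test

theorem IsTest.comp_apply {ψ : E d → V3} (hψ : IsTest Ω ψ) (i : Fin 3) :
    IsTest Ω (fun x => ψ x i) := by
  refine ⟨(contDiff_coord i).comp hψ.1, hψ.2.1.comp_left (g := fun v : V3 => v i) rfl, ?_⟩
  exact (tsupport_comp_subset (g := fun v : V3 => v i) rfl ψ).trans hψ.2.2

theorem IsWeakDiv.add {a b : E d → V3} {g h : E d → ℝ} (ha : MemLp a 2 (volume.restrict Ω))
    (hb : MemLp b 2 (volume.restrict Ω)) (hg : IsWeakDiv Ω a g) (hh : IsWeakDiv Ω b h) :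
    IsWeakDiv Ω (fun x => a x + b x) (fun x => g x + h x) := by
  refine ⟨hg.1.add hh.1, fun ψ hψ => ?_⟩
  simp only [inner_add_left, add_mul]
  rw [integral_add (integrable_inner_of_memLp ha hψ.memLp_grad)
    (integrable_inner_of_memLp hb hψ.memLp_grad), hg.2 ψ hψ, hh.2 ψ hψ,
    integral_add (integrable_mul_of_memLp hg.1 hψ.memLp) (integrable_mul_of_memLp hh.1 hψ.memLp), neg_add]

theorem IsWeakDiv.const_smul {a : E d → V3} {g : E d → ℝ} (c : ℝ) (hg : IsWeakDiv Ω a g) :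
    IsWeakDiv Ω (fun x => c • a x) (fun x => c * g x) := by
  refine ⟨hg.1.const_mul c, fun ψ hψ => ?_⟩
  simp only [real_inner_smul_left, mul_assoc, integral_const_mul, hg.2 ψ hψ, mul_neg]

/-- Weak divergences are unique by the fundamental lemma of the calculus of variations. -/
theorem IsWeakDiv.unique (hΩ : IsOpen Ω) {a : E d → V3} {g h : E d → ℝ} (hg : IsWeakDiv Ω a g)
    (hh : IsWeakDiv Ω a h) : g =ᵐ[volume.restrict Ω] h := by
  have hloc : LocallyIntegrableOn (fun x => g x - h x) Ω volume :=
    locallyIntegrableOn_of_locallyIntegrable_restrict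
      ((hg.1.sub hh.1).locallyIntegrable (by norm_num))
  have key := hΩ.ae_eq_zero_of_integral_contDiff_smul_eq_zero hloc fun ψ h1 h2 h3 => ?_
  · rw [EventuallyEq, ae_restrict_iff' hΩ.measurableSet]
    filter_upwards [key] with x hx hxΩ using sub_eq_zero.1 (hx hxΩ)
  · have hψ : IsTest Ω ψ := ⟨h1, h2, h3⟩
    rw [← setIntegral_eq_integral_of_forall_compl_eq_zero (s := Ω)]
    · have e : ∫ x in Ω, g x * ψ x = ∫ x in Ω, h x * ψ x :=
        neg_injective ((hg.2 ψ hψ).symm.trans (hh.2 ψ hψ))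
      have i1 := integrable_mul_of_memLp hg.1 hψ.memLp
      have i2 := integrable_mul_of_memLp hh.1 hψ.memLp
      have : ∀ x, ψ x • (g x - h x) = g x * ψ x - h x * ψ x := fun x => by
        rw [smul_eq_mul]; ring
      simp only [this]
      rw [integral_sub i1 i2, e, sub_self]
    · intro x hx
      rw [image_eq_zero_of_notMem_tsupport fun h => hx (h3 h), zero_smul]

theorem isWeakDiv_const (c : V3) : IsWeakDiv Ω (fun _ => c) (fun _ => 0) := by
  refine ⟨MemLp.zero', fun ψ hψ => ?_⟩
  have hi : ∀ j, Integrable (pd j ψ) (volume.restrict Ω) := fun j =>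
    ((hψ.continuous_pd j).integrable_of_hasCompactSupport (hψ.hasCompactSupport_pd j)).restrict
  simp only [inner_V3, grad_apply]
  rw [integral_add_three ((hi 0).const_mul _) ((hi 1).const_mul _) ((hi 2).const_mul _)]
  simp [integral_const_mul, hψ.integral_pd]

/-- The linear map `v ↦ e_i × v`. The `i`-th component of the curl of `v` is minus the divergence
of `e_i × v`. -/
noncomputable def rot (i : Fin 3) : V3 →L[ℝ] V3 :=
  (EuclideanSpace.proj (i + 1) : V3 →L[ℝ] ℝ).smulRight (EuclideanSpace.single (i + 2) 1) -
    (EuclideanSpace.proj (i + 2) : V3 →L[ℝ] ℝ).smulRight (EuclideanSpace.single (i + 1) 1)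

theorem inner_rot (i : Fin 3) (v w : V3) :
    inner ℝ (rot i v) w = v (i + 1) * w (i + 2) - v (i + 2) * w (i + 1) := by
  simp only [rot, sub_apply, ContinuousLinearMap.smulRight_apply, PiLp.proj_apply,
    inner_sub_left, real_inner_smul_left, EuclideanSpace.inner_single_left]
  simp

theorem pd_zero (j : Fin 3) (x : E d) : pd j (fun _ => (0 : ℝ)) x = 0 := by
  rw [pd_eq_fderiv]; simp

theorem inner_curl_smul_single (i : Fin 3) (v : V3) (ψ : E d → ℝ) (x : E d) :
    inner ℝ v (curl (fun y => ψ y • (EuclideanSpace.single i 1 : V3)) x) =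
      inner ℝ (rot i v) (grad ψ x) := by
  rw [inner_rot, grad_apply, grad_apply, inner_V3]
  fin_cases i <;> simp [curl, pd_zero] <;> ring

theorem inner_curl_eq (v : V3) (ψ : E d → V3) (x : E d) :
    inner ℝ v (curl ψ x) = inner ℝ (rot 0 v) (grad (fun y => ψ y 0) x) +
      inner ℝ (rot 1 v) (grad (fun y => ψ y 1) x) +
      inner ℝ (rot 2 v) (grad (fun y => ψ y 2) x) := by
  rw [inner_rot, inner_rot, inner_rot, inner_V3]
  simp [grad_apply, curl]
  ring

theorem memLp_rot {v : E d → V3} (hv : MemLp v 2 (volume.restrict Ω)) (i : Fin 3) :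
    MemLp (fun x => rot i (v x)) 2 (volume.restrict Ω) := (rot i).comp_memLp' hv

theorem isWeakCurl_iff {v w : E d → V3} (hv : MemLp v 2 (volume.restrict Ω)) :
    IsWeakCurl Ω v w ↔ ∀ i, IsWeakDiv Ω (fun x => rot i (v x)) (fun x => -w x i) := by
  constructor
  · refine fun h i => ⟨(h.1.eval_piLp i).neg, fun ψ hψ => ?_⟩
    have := h.2 _ (hψ.smul_single i)
    simp only [inner_curl_smul_single] at this
    rw [this, ← integral_neg]
    congr 1 with x
    rw [real_inner_smul_right, EuclideanSpace.inner_single_right]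
    simp [mul_comm]
  · intro h
    have hw : MemLp w 2 (volume.restrict Ω) :=
      MemLp.of_eval_piLp fun i => by simpa [Pi.neg_def] using (h i).1.neg
    refine ⟨hw, fun ψ hψ => ?_⟩
    have hg := fun i => (hψ.comp_apply i).memLp_grad
    have hi := fun i => integrable_inner_of_memLp (memLp_rot hv i) (hg i)
    have hj : ∀ i, Integrable (fun x => w x i * ψ x i) (volume.restrict Ω) := fun i =>
      integrable_mul_of_memLp (hw.eval_piLp i) (hψ.comp_apply i).memLp
    have he : ∀ i, ∫ x in Ω, inner ℝ (rot i (v x)) (grad (fun y => ψ y i) x) =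
        ∫ x in Ω, w x i * ψ x i := fun i => by
      rw [(h i).2 _ (hψ.comp_apply i), ← integral_neg]; simp
    simp only [inner_curl_eq]
    rw [integral_add_three (hi 0) (hi 1) (hi 2), he, he, he]
    simp only [inner_V3]
    rw [integral_add_three (hj 0) (hj 1) (hj 2)]

theorem divg_smul_single (i : Fin 3) (ψ : E d → ℝ) (x : E d) :
    divg (fun y => ψ y • (EuclideanSpace.single i 1 : V3)) x = pd i ψ x := by
  fin_cases i <;> simp [divg, pd_zero]

theorem isWeakGrad_iff {u : E d → ℝ} {g : E d → V3} (hu : MemLp u 2 (volume.restrict Ω)) :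
    IsWeakGrad Ω u g ↔
      ∀ i, IsWeakDiv Ω (fun x => u x • (EuclideanSpace.single i 1 : V3)) (fun x => g x i) := by
  constructor
  · refine fun h i => ⟨h.1.eval_piLp i, fun ψ hψ => ?_⟩
    have := h.2 _ (hψ.smul_single i)
    simp only [divg_smul_single] at this
    simp only [real_inner_smul_left, EuclideanSpace.inner_single_left, grad_apply, map_one, one_mul]
    rw [this]
    congr 2 with x
    rw [real_inner_smul_right, EuclideanSpace.inner_single_right]
    simp [mul_comm]
  · intro h
    have hg : MemLp g 2 (volume.restrict Ω) := MemLp.of_eval_piLp fun i => (h i).1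
    refine ⟨hg, fun ψ hψ => ?_⟩
    have hi : ∀ i, Integrable (fun x => u x * pd i (fun y => ψ y i) x) (volume.restrict Ω) :=
      fun i => integrable_mul_of_memLp hu (((hψ.comp_apply i).continuous_pd i).memLp_of_hasCompactSupport
        ((hψ.comp_apply i).hasCompactSupport_pd i))
    have hj : ∀ i, Integrable (fun x => g x i * ψ x i) (volume.restrict Ω) := fun i =>
      integrable_mul_of_memLp (hg.eval_piLp i) (hψ.comp_apply i).memLp
    have he : ∀ i, ∫ x in Ω, u x * pd i (fun y => ψ y i) x = - ∫ x in Ω, g x i * ψ x i := fun i => by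
      rw [← (h i).2 _ (hψ.comp_apply i)]
      simp [real_inner_smul_left, EuclideanSpace.inner_single_left, grad_apply]
    simp only [divg, inner_V3, mul_add]
    rw [integral_add_three (hi 0) (hi 1) (hi 2), he, he, he,
      integral_add_three (hj 0) (hj 1) (hj 2)]
    ring

theorem ae_eq_of_coord {v w : E d → V3} {ν : Measure (E d)}
    (h : ∀ i, (fun x => v x i) =ᵐ[ν] fun x => w x i) : v =ᵐ[ν] w := by
  filter_upwards [ae_all_iff.2 h] with x hx
  ext i
  exact hx i

theorem IsWeakCurl.unique (hΩ : IsOpen Ω) {v w w' : E d → V3}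
    (hv : MemLp v 2 (volume.restrict Ω)) (h : IsWeakCurl Ω v w) (h' : IsWeakCurl Ω v w') :
    w =ᵐ[volume.restrict Ω] w' :=
  ae_eq_of_coord fun i => by
    filter_upwards [((isWeakCurl_iff hv).1 h i).unique hΩ ((isWeakCurl_iff hv).1 h' i)] with x hx
    exact neg_injective hx

theorem IsWeakCurl.add {v v' w w' : E d → V3} (hv : MemLp v 2 (volume.restrict Ω))
    (hv' : MemLp v' 2 (volume.restrict Ω)) (h : IsWeakCurl Ω v w) (h' : IsWeakCurl Ω v' w') :
    IsWeakCurl Ω (v + v') (w + w') := by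
  refine (isWeakCurl_iff (hv.add hv')).2 fun i => ?_
  have := ((isWeakCurl_iff hv).1 h i).add (memLp_rot hv i) (memLp_rot hv' i)
    ((isWeakCurl_iff hv').1 h' i)
  simpa [map_add, neg_add, add_comm] using this

theorem IsWeakCurl.const_smul {v w : E d → V3} (hv : MemLp v 2 (volume.restrict Ω)) (c : ℝ)
    (h : IsWeakCurl Ω v w) : IsWeakCurl Ω (c • v) (c • w) := by
  refine (isWeakCurl_iff (hv.const_smul c)).2 fun i => ?_
  simpa using ((isWeakCurl_iff hv).1 h i).const_smul c

theorem IsWeakGrad.unique (hΩ : IsOpen Ω) {u : E d → ℝ} {g g' : E d → V3}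
    (hu : MemLp u 2 (volume.restrict Ω)) (h : IsWeakGrad Ω u g) (h' : IsWeakGrad Ω u g') :
    g =ᵐ[volume.restrict Ω] g' :=
  ae_eq_of_coord fun i => ((isWeakGrad_iff hu).1 h i).unique hΩ ((isWeakGrad_iff hu).1 h' i)

theorem IsWeakGrad.add {u u' : E d → ℝ} {g g' : E d → V3} (hu : MemLp u 2 (volume.restrict Ω))
    (hu' : MemLp u' 2 (volume.restrict Ω)) (h : IsWeakGrad Ω u g) (h' : IsWeakGrad Ω u' g') :
    IsWeakGrad Ω (u + u') (g + g') := by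
  refine (isWeakGrad_iff (hu.add hu')).2 fun i => ?_
  have hs : ∀ {u : E d → ℝ}, MemLp u 2 (volume.restrict Ω) →
      MemLp (fun x => u x • (EuclideanSpace.single i 1 : V3)) 2 (volume.restrict Ω) := fun hu =>
    ((ContinuousLinearMap.id ℝ ℝ).smulRight (EuclideanSpace.single i 1 : V3)).comp_memLp' hu
  have := ((isWeakGrad_iff hu).1 h i).add (hs hu) (hs hu') ((isWeakGrad_iff hu').1 h' i)
  simpa [add_smul] using this

theorem IsWeakGrad.const_smul {u : E d → ℝ} {g : E d → V3} (hu : MemLp u 2 (volume.restrict Ω))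
    (c : ℝ) (h : IsWeakGrad Ω u g) : IsWeakGrad Ω (c • u) (c • g) := by
  refine (isWeakGrad_iff (hu.const_smul c)).2 fun i => ?_
  simpa [smul_smul] using ((isWeakGrad_iff hu).1 h i).const_smul c

theorem IsWeakGrad.congr_left {u u' : E d → ℝ} {g : E d → V3} (h : IsWeakGrad Ω u g)
    (huu' : u =ᵐ[volume.restrict Ω] u') : IsWeakGrad Ω u' g := by
  refine ⟨h.1, fun ψ hψ => (h.2 ψ hψ).symm.trans ?_ |>.symm⟩
  refine integral_congr_ae ?_
  filter_upwards [huu'] with x hx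
  rw [hx]

theorem isWeakDiv_weakDiv {v : E d → V3} (h : ∃ g, IsWeakDiv Ω v g) :
    IsWeakDiv Ω v (weakDiv Ω v) := by
  rw [weakDiv, dif_pos h]; exact h.choose_spec

theorem isWeakCurl_weakCurl {v : E d → V3} (h : ∃ g, IsWeakCurl Ω v g) :
    IsWeakCurl Ω v (weakCurl Ω v) := by
  rw [weakCurl, dif_pos h]; exact h.choose_spec

theorem isWeakGrad_weakGrad {u : E d → ℝ} (h : ∃ g, IsWeakGrad Ω u g) :
    IsWeakGrad Ω u (weakGrad Ω u) := by
  rw [weakGrad, dif_pos h]; exact h.choose_spec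

/-! ### The finite-element fields lie in `H(div; Ω) ∩ H(curl; Ω)` -/

theorem MemHDC.add {v w : E d → V3} (hv : MemHDC Ω v) (hw : MemHDC Ω w) : MemHDC Ω (v + w) := by
  obtain ⟨hv, ⟨g, hg⟩, c, hc⟩ := hv
  obtain ⟨hw, ⟨g', hg'⟩, c', hc'⟩ := hw
  exact ⟨hv.add hw, ⟨_, hg.add hv hw hg'⟩, _, hc.add hv hw hc'⟩

theorem memHDC_const (hΩb : Bornology.IsBounded Ω) (c : V3) : MemHDC Ω fun _ => c := by
  have := isFiniteMeasure_restrict hΩb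
  refine ⟨memLp_const c, ⟨_, isWeakDiv_const c⟩, 0, (isWeakCurl_iff (memLp_const c)).2 fun i => ?_⟩
  simpa using isWeakDiv_const (rot i c)

theorem memLp_lipschitz_smul {a : E d → V3} (ha : MemLp a 2 (volume.restrict Ω)) {β : E d → ℝ}
    {C : ℝ≥0} (hβ : LipschitzWith C β) {B : ℝ} (hB : ∀ x, |β x| ≤ B) :
    MemLp (fun x => β x • a x) 2 (volume.restrict Ω) :=
  ha.of_le_mul (c := B) (hβ.continuous.aestronglyMeasurable.smul ha.1)
    (Eventually.of_forall fun x => by rw [norm_smul]; gcongr; exact hB x)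

/-- The weak curl of `β n` is computed from the Leibniz rule for the divergence of
`β (e_i × n)`. -/
theorem MemHDC.lipschitz_smul (hΩ : IsOpen Ω) (hΩb : Bornology.IsBounded Ω) {n : E d → V3}
    (hn : MemHDC Ω n) {β : E d → ℝ} {C : ℝ≥0} (hβ : LipschitzWith C β) {B : ℝ}
    (hB : ∀ x, |β x| ≤ B) : MemHDC Ω fun x => β x • n x := by
  obtain ⟨hn, ⟨g, hg⟩, w, hw⟩ := hn
  have hβn := memLp_lipschitz_smul hn hβ hB
  refine ⟨hβn, ⟨_, hg.lipschitz_smul hΩ hΩb hn hβ hB⟩,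
    fun x => WithLp.toLp 2 fun i => -(β x * -w x i + inner ℝ (rot i (n x)) (lineGrad β x)),
    (isWeakCurl_iff hβn).2 fun i => ?_⟩
  have := ((isWeakCurl_iff hn).1 hw i).lipschitz_smul hΩ hΩb (memLp_rot hn i) hβ hB
  simpa only [map_smul, neg_neg] using this

/-- A field of `H(div; Ω) ∩ H(curl; Ω)` that is bounded on `Ω`. -/
def IsRegular (Ω : Set (E d)) (v : E d → V3) : Prop := MemHDC Ω v ∧ ∃ C, ∀ x ∈ Ω, ‖v x‖ ≤ C

theorem isRegular_zero (hΩb : Bornology.IsBounded Ω) : IsRegular Ω (0 : E d → V3) :=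
  ⟨memHDC_const hΩb 0, 0, by simp⟩

theorem IsRegular.add {v w : E d → V3} (hv : IsRegular Ω v) (hw : IsRegular Ω w) :
    IsRegular Ω (v + w) := by
  obtain ⟨hv, C, hC⟩ := hv
  obtain ⟨hw, D, hD⟩ := hw
  exact ⟨hv.add hw, C + D, fun x hx =>
    (norm_add_le _ _).trans (add_le_add (hC x hx) (hD x hx))⟩

theorem isRegular_sum (hΩb : Bornology.IsBounded Ω) {ι : Type*} (s : Finset ι)
    {v : ι → E d → V3} (h : ∀ i, IsRegular Ω (v i)) : IsRegular Ω (∑ i ∈ s, v i) :=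
  Finset.sum_induction v (IsRegular Ω) (fun _ _ => IsRegular.add) (isRegular_zero hΩb)
    fun i _ => h i

/-- A bounded field of `H(div; Ω) ∩ H(curl; Ω)` may be multiplied by a Lipschitz function that
vanishes outside `Ω`. -/
theorem IsRegular.lipschitz_smul (hΩ : IsOpen Ω) (hΩb : Bornology.IsBounded Ω) {n : E d → V3}
    (hn : IsRegular Ω n) {β : E d → ℝ} {C : ℝ≥0} (hβ : LipschitzWith C β)
    (hβ0 : ∀ x ∉ Ω, β x = 0) : IsRegular Ω fun x => β x • n x := by
  have hc : HasCompactSupport β := HasCompactSupport.intro hΩb.isCompact_closure fun x hx =>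
    hβ0 x fun h => hx (subset_closure h)
  obtain ⟨B, hB⟩ := hc.exists_bound_of_continuous hβ.continuous
  obtain ⟨hn, D, hD⟩ := hn
  refine ⟨hn.lipschitz_smul hΩ hΩb hβ hB, B * D, fun x hx => ?_⟩
  rw [norm_smul]
  exact mul_le_mul (hB x) (hD x hx) (norm_nonneg _) ((norm_nonneg _).trans (hB 0))

section Space

variable {𝒯 : QuadMesh d Ω} {m : ℕ} {n : E d → V3}

theorem isRegular_director (hΩb : Bornology.IsBounded Ω) (hn : MemHDC Ω n)
    (hnc : ContinuousOn n (closure Ω)) : IsRegular Ω n := by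
  obtain ⟨C, hC⟩ := hΩb.isCompact_closure.exists_bound_of_continuousOn hnc
  exact ⟨hn, C, fun x hx => hC x (subset_closure hx)⟩

/-- The bubble space is spanned by the fields `b_T n`. -/
theorem eq_sum_of_mem_spaceBubble {w : E d → V3} (hw : w ∈ spaceBubble 𝒯 n) :
    ∃ a : Fin 𝒯.numCells → ℝ, w = ∑ T, fun x => (a T * 𝒯.bubble T x) • n x := by
  obtain ⟨-, hw0, hw⟩ := hw
  choose a ha using hw
  refine ⟨a, funext fun x => ?_⟩
  rw [Finset.sum_apply]
  by_cases hx : ∃ T, x ∈ 𝒯.openCell T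
  · obtain ⟨T, ξ, hξ, rfl⟩ := hx
    have hξ' := refCubeOpen_subset_refCube hξ
    rw [Finset.sum_eq_single T, QuadMesh.bubble_cellMap hξ', ha T ξ hξ']
    · intro T' _ hT
      rw [QuadMesh.bubble_cellMap_of_ne hT.symm hξ', mul_zero, zero_smul]
    · simp
  · push Not at hx
    rw [Finset.sum_eq_zero fun T _ => by rw [QuadMesh.bubble_of_notMem (hx T), mul_zero, zero_smul]]
    by_cases hxΩ : x ∈ Ω
    · obtain ⟨T, ξ, hξ, rfl⟩ := (𝒯.mem_closure_iff x).1 (subset_closure hxΩ)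
      rw [ha T ξ hξ, refBubble_eq_zero hξ fun h => hx T ⟨ξ, h, rfl⟩, mul_zero, zero_smul]
    · exact hw0 x hxΩ

theorem eq_zero_of_mem_spaceV {v : E d → V3} (hΩ : IsOpen Ω) (hv : v ∈ spaceV 𝒯 m n) {x : E d}
    (hx : x ∉ Ω) : v x = 0 := by
  by_cases hxc : x ∈ closure Ω
  · exact hv.2 x (by rw [hΩ.frontier_eq]; exact ⟨hxc, hx⟩)
  · obtain ⟨q, hq, w, hw, rfl⟩ := Submodule.mem_sup.1 hv.1
    have : q x = 0 := by ext i; exact (hq i).2.1 x hxc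
    rw [Pi.add_apply, this, hw.2.1 x hx, add_zero]

theorem continuousOn_of_mem_spaceV {v : E d → V3} (hv : v ∈ spaceV 𝒯 m n) : ContinuousOn v Ω := by
  obtain ⟨q, hq, w, hw, rfl⟩ := Submodule.mem_sup.1 hv.1
  have : ContinuousOn q (closure Ω) :=
    (PiLp.continuous_toLp 2 fun _ : Fin 3 => ℝ).comp_continuousOn
      (continuousOn_pi.2 fun i => (hq i).1)
  exact (this.mono subset_closure).add hw.1.continuousOn

/-- The fields of `V_h` are bounded and lie in `H(div; Ω) ∩ H(curl; Ω)`. -/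
theorem isRegular_of_mem_spaceV (hΩ : IsOpen Ω) (hΩb : Bornology.IsBounded Ω)
    (hn : IsRegular Ω n) {v : E d → V3} (hv : v ∈ spaceV 𝒯 m n) : IsRegular Ω v := by
  have hv' := hv
  obtain ⟨q, hq, w, hw, rfl⟩ := Submodule.mem_sup.1 hv.1
  refine IsRegular.add ?_ ?_
  · have hq0 : ∀ x ∉ Ω, q x = 0 := fun x hx => by
      simpa [hw.2.1 x hx] using eq_zero_of_mem_spaceV hΩ hv' hx
    have hqe : q = ∑ i : Fin 3, fun x => q x i • (EuclideanSpace.single i 1 : V3) := by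
      funext x
      ext j
      fin_cases j <;> simp [Finset.sum_apply, Fin.sum_univ_three]
    rw [hqe]
    refine isRegular_sum hΩb _ fun i => ?_
    obtain ⟨C, hC⟩ := 𝒯.exists_lipschitzWith hΩ (f := fun x => q x i)
      (fun x hx => by rw [hq0 x hx]; rfl) fun T => by
        obtain ⟨p, -, hp⟩ := (hq i).2.2 T
        exact ⟨_, contDiff_mvPolynomial_eval p, hp⟩
    exact IsRegular.lipschitz_smul hΩ hΩb (n := fun _ => EuclideanSpace.single i 1)
      ⟨memHDC_const hΩb _, _, fun _ _ => le_rfl⟩ hC fun x hx => by rw [hq0 x hx]; rfl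
  · obtain ⟨a, rfl⟩ := eq_sum_of_mem_spaceBubble hw
    refine isRegular_sum hΩb _ fun T => ?_
    obtain ⟨C, hC⟩ := QuadMesh.exists_lipschitzWith_bubble (𝒯 := 𝒯) hΩ T
    have hC' : LipschitzWith (‖a T‖₊ * C) fun x => a T * 𝒯.bubble T x :=
      LipschitzWith.of_dist_le_mul fun x y => by
        rw [Real.dist_eq, ← mul_sub, abs_mul, NNReal.coe_mul, mul_assoc, coe_nnnorm,
          Real.norm_eq_abs, ← Real.dist_eq]
        gcongr
        exact hC.dist_le_mul x y
    exact hn.lipschitz_smul hΩ hΩb hC' fun x hx => by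
      rw [QuadMesh.bubble_eq_zero_of_notMem hx, mul_zero]

theorem bubble_smul_mem_spaceV (hΩ : IsOpen Ω) (hnc : ContinuousOn n (closure Ω))
    (T : Fin 𝒯.numCells) : (fun x => 𝒯.bubble T x • n x) ∈ spaceV 𝒯 m n := by
  obtain ⟨C, hC⟩ := QuadMesh.exists_lipschitzWith_bubble (𝒯 := 𝒯) hΩ T
  have h0 : ∀ x ∉ Ω, 𝒯.bubble T x • n x = 0 := fun x hx => by
    rw [QuadMesh.bubble_eq_zero_of_notMem hx, zero_smul]
  refine ⟨Submodule.mem_sup_right ⟨?_, h0, fun T' => ?_⟩, fun x hx => h0 x ?_⟩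
  · rw [← continuousOn_univ, ← union_compl_self (closure Ω)]
    refine ContinuousOn.mono (s := closure Ω ∪ Ωᶜ) ?_
      (union_subset_union_right _ (compl_subset_compl.2 subset_closure))
    refine ContinuousOn.union_of_isClosed (hC.continuous.continuousOn.smul hnc)
      ((continuousOn_const (c := (0 : V3))).congr fun x hx => h0 x hx)
      isClosed_closure hΩ.isClosed_compl
  · by_cases h : T' = T
    · subst h
      exact ⟨1, fun ξ hξ => by simp only [QuadMesh.bubble_cellMap hξ, one_mul]⟩
    · exact ⟨0, fun ξ hξ => by
        simp only [QuadMesh.bubble_cellMap_of_ne h hξ, zero_mul, zero_smul]⟩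
  · rw [hΩ.frontier_eq] at hx
    exact hx.2

end Space

/-! ### Bilinearity of the forms -/

section Bilinear

variable {α M N F G : Type*} [MeasurableSpace α] {ν : Measure α} [AddCommGroup M] [Module ℝ M]
  [AddCommGroup N] [Module ℝ N] [NormedAddCommGroup F] [InnerProductSpace ℝ F]
  [NormedAddCommGroup G] [InnerProductSpace ℝ G]

/-- `P` represents a linear map into `L²(ν; F)`: its values are square integrable functions, and
it is linear up to equality almost everywhere. -/
structure IsL2Linear (ν : Measure α) (P : M → α → F) : Prop where
  memLp : ∀ u, MemLp (P u) 2 ν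
  add : ∀ u v, P (u + v) =ᵐ[ν] P u + P v
  smul : ∀ (c : ℝ) u, P (c • u) =ᵐ[ν] c • P u

/-- The function `f` of two variables is a bilinear form. -/
def IsBilin (f : M → N → ℝ) : Prop := ∃ B : M →ₗ[ℝ] N →ₗ[ℝ] ℝ, ∀ u v, B u v = f u v

theorem IsBilin.add {f g : M → N → ℝ} (hf : IsBilin f) (hg : IsBilin g) :
    IsBilin fun u v => f u v + g u v := by
  obtain ⟨A, hA⟩ := hf
  obtain ⟨B, hB⟩ := hg
  exact ⟨A + B, fun u v => by simp [hA, hB]⟩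

theorem IsBilin.const_mul {f : M → N → ℝ} (hf : IsBilin f) (c : ℝ) :
    IsBilin fun u v => c * f u v := by
  obtain ⟨A, hA⟩ := hf
  exact ⟨c • A, fun u v => by simp [hA]⟩

theorem IsBilin.sub {f g : M → N → ℝ} (hf : IsBilin f) (hg : IsBilin g) :
    IsBilin fun u v => f u v - g u v := by
  obtain ⟨A, hA⟩ := hf
  obtain ⟨B, hB⟩ := hg
  exact ⟨A - B, fun u v => by simp [hA, hB]⟩

theorem IsL2Linear.exists_linearMap {P : M → α → F} (hP : IsL2Linear ν P) :
    ∃ L : M →ₗ[ℝ] Lp F 2 ν, ∀ u, L u =ᵐ[ν] P u :=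
  ⟨{  toFun := fun u => (hP.memLp u).toLp (P u)
      map_add' := fun u v => by
        rw [← MemLp.toLp_add]
        exact MemLp.toLp_congr _ _ (hP.add u v)
      map_smul' := fun c u => by
        rw [RingHom.id_apply, ← MemLp.toLp_const_smul]
        exact MemLp.toLp_congr _ _ (hP.smul c u) }, fun u => (hP.memLp u).coeFn_toLp⟩

theorem IsL2Linear.isBilin_inner {P : M → α → F} {Q : N → α → F} (hP : IsL2Linear ν P)
    (hQ : IsL2Linear ν Q) : IsBilin fun u v => ∫ x, inner ℝ (P u x) (Q v x) ∂ν := by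
  obtain ⟨LP, hLP⟩ := hP.exists_linearMap
  obtain ⟨LQ, hLQ⟩ := hQ.exists_linearMap
  refine ⟨(innerₗ (Lp F 2 ν)).compl₁₂ LP LQ, fun u v => ?_⟩
  rw [LinearMap.compl₁₂_apply, innerₗ_apply_apply, L2.inner_def]
  refine integral_congr_ae ?_
  filter_upwards [hLP u, hLQ v] with x h1 h2
  rw [h1, h2]

theorem IsL2Linear.isBilin_mul {P : M → α → ℝ} {Q : N → α → ℝ} (hP : IsL2Linear ν P)
    (hQ : IsL2Linear ν Q) : IsBilin fun u v => ∫ x, P u x * Q v x ∂ν := by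
  simpa [mul_comm] using hP.isBilin_inner hQ

/-- Pointwise linear maps act on square integrable functions as long as square integrability is
preserved. -/
theorem IsL2Linear.map {P : M → α → F} (hP : IsL2Linear ν P) (A : α → F → G)
    (hadd : ∀ x a b, A x (a + b) = A x a + A x b) (hsmul : ∀ x (c : ℝ) a, A x (c • a) = c • A x a)
    (hA : ∀ u, MemLp (fun x => A x (P u x)) 2 ν) : IsL2Linear ν fun u x => A x (P u x) where
  memLp := hA
  add u v := by
    filter_upwards [hP.add u v] with x hx
    rw [hx, Pi.add_apply, hadd, Pi.add_apply]
  smul c u := by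
    filter_upwards [hP.smul c u] with x hx
    rw [hx, Pi.smul_apply, hsmul, Pi.smul_apply]

theorem memLp_smul_of_bounded {s : α → ℝ} {n : α → F} {C : ℝ} (hs : MemLp s 2 ν)
    (hn : AEStronglyMeasurable n ν) (hC : ∀ᵐ x ∂ν, ‖n x‖ ≤ C) :
    MemLp (fun x => s x • n x) 2 ν :=
  hs.of_le_mul (c := C) (hs.1.smul hn) (by
    filter_upwards [hC] with x hx
    rw [norm_smul, mul_comm]
    gcongr)

theorem memLp_inner_of_bounded {p n : α → F} {C : ℝ} (hp : MemLp p 2 ν)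
    (hn : AEStronglyMeasurable n ν) (hC : ∀ᵐ x ∂ν, ‖n x‖ ≤ C) :
    MemLp (fun x => inner ℝ (n x) (p x)) 2 ν :=
  hp.of_le_mul (c := C) (hn.inner hp.1) (by
    filter_upwards [hC] with x hx
    exact (norm_inner_le_norm _ _).trans (by gcongr))

end Bilinear

theorem IsRegular.ae_bound (hΩ : IsOpen Ω) {v : E d → V3} (hv : IsRegular Ω v) :
    ∃ C, ∀ᵐ x ∂(volume.restrict Ω), ‖v x‖ ≤ C := by
  obtain ⟨-, C, hC⟩ := hv
  exact ⟨C, ae_restrict_of_forall_mem hΩ.measurableSet hC⟩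

section Director

variable {S : Submodule ℝ (E d → V3)}

theorem isL2Linear_val (hS : ∀ v : S, IsRegular Ω (v : E d → V3)) :
    IsL2Linear (volume.restrict Ω) fun v : S => (v : E d → V3) where
  memLp v := (hS v).1.1
  add _ _ := EventuallyEq.rfl
  smul _ _ := EventuallyEq.rfl

theorem isL2Linear_weakDiv (hS : ∀ v : S, IsRegular Ω (v : E d → V3))
    (hΩ : IsOpen Ω) :
    IsL2Linear (volume.restrict Ω) fun v : S => weakDiv Ω (v : E d → V3) where
  memLp v := (isWeakDiv_weakDiv (hS v).1.2.1).1
  add u v := (isWeakDiv_weakDiv (hS (u + v)).1.2.1).unique hΩ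
    ((isWeakDiv_weakDiv (hS u).1.2.1).add (hS u).1.1 (hS v).1.1 (isWeakDiv_weakDiv (hS v).1.2.1))
  smul c u := (isWeakDiv_weakDiv (hS (c • u)).1.2.1).unique hΩ
    ((isWeakDiv_weakDiv (hS u).1.2.1).const_smul c)

theorem isL2Linear_weakCurl (hS : ∀ v : S, IsRegular Ω (v : E d → V3))
    (hΩ : IsOpen Ω) :
    IsL2Linear (volume.restrict Ω) fun v : S => weakCurl Ω (v : E d → V3) where
  memLp v := (isWeakCurl_weakCurl (hS v).1.2.2).1
  add u v := (isWeakCurl_weakCurl (hS (u + v)).1.2.2).unique hΩ (hS (u + v)).1.1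
    ((isWeakCurl_weakCurl (hS u).1.2.2).add (hS u).1.1 (hS v).1.1
      (isWeakCurl_weakCurl (hS v).1.2.2))
  smul c u := (isWeakCurl_weakCurl (hS (c • u)).1.2.2).unique hΩ (hS (c • u)).1.1
    ((isWeakCurl_weakCurl (hS u).1.2.2).const_smul (hS u).1.1 c)

theorem isL2Linear_smul_val (hS : ∀ v : S, IsRegular Ω (v : E d → V3))
    (hΩ : IsOpen Ω) {s : E d → ℝ} (hs : MemLp s 2 (volume.restrict Ω)) :
    IsL2Linear (volume.restrict Ω) fun (v : S) x => s x • (v : E d → V3) x :=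
  (isL2Linear_val hS).map (fun x a => s x • a) (fun _ _ _ => smul_add _ _ _)
    (fun _ _ _ => smul_comm _ _ _) fun v => by
      obtain ⟨C, hC⟩ := (hS v).ae_bound hΩ
      exact memLp_smul_of_bounded hs (hS v).1.1.1 hC

theorem isL2Linear_inner_val (hS : ∀ v : S, IsRegular Ω (v : E d → V3))
    (hΩ : IsOpen Ω) {g : E d → V3} (hg : MemLp g 2 (volume.restrict Ω)) :
    IsL2Linear (volume.restrict Ω) fun (v : S) x => (inner ℝ ((v : E d → V3) x) (g x) : ℝ) :=
  (isL2Linear_val hS).map (fun x a => inner ℝ a (g x)) (fun _ _ _ => inner_add_left _ _ _)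
    (fun _ _ _ => real_inner_smul_left _ _ _) fun v => by
      obtain ⟨C, hC⟩ := (hS v).ae_bound hΩ
      exact memLp_inner_of_bounded hg (hS v).1.1.1 hC

end Director

theorem IsL2Linear.inner_director {M : Type*} [AddCommGroup M] [Module ℝ M] (hΩ : IsOpen Ω)
    {n : E d → V3} (hn : IsRegular Ω n) {P : M → E d → V3}
    (hP : IsL2Linear (volume.restrict Ω) P) :
    IsL2Linear (volume.restrict Ω) fun u x => (inner ℝ (n x) (P u x) : ℝ) :=
  hP.map (fun x a => inner ℝ (n x) a) (fun _ _ _ => inner_add_right _ _ _)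
    (fun _ _ _ => real_inner_smul_right _ _ _) fun u => by
      obtain ⟨C, hC⟩ := hn.ae_bound hΩ
      exact memLp_inner_of_bounded (hP.memLp u) hn.1.1.1 hC

theorem IsL2Linear.applyZ {M : Type*} [AddCommGroup M] [Module ℝ M] (hΩ : IsOpen Ω)
    {n : E d → V3} (hn : IsRegular Ω n) (κ : ℝ) {P : M → E d → V3}
    (hP : IsL2Linear (volume.restrict Ω) P) :
    IsL2Linear (volume.restrict Ω) fun u x => applyZ κ (n x) (P u x) := by
  refine hP.map (fun x a => NematicFE.applyZ κ (n x) a) (fun x a b => ?_) (fun x c a => ?_)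
    fun u => ?_
  · simp only [NematicFE.applyZ, inner_add_right, mul_add, add_smul]; abel
  · simp only [NematicFE.applyZ, real_inner_smul_right, smul_sub, smul_smul]
    congr 2; ring
  · obtain ⟨C, hC⟩ := hn.ae_bound hΩ
    exact (hP.memLp u).sub (memLp_smul_of_bounded
      ((memLp_inner_of_bounded (hP.memLp u) hn.1.1.1 hC).const_mul (1 - κ)) hn.1.1.1 hC)

section Potential

variable {Φ : Submodule ℝ (Lp ℝ 2 (volume.restrict Ω))}

theorem isL2Linear_weakGrad (hΩ : IsOpen Ω) (hΦ : ∀ u ∈ Φ, MemH1 Ω u) :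
    IsL2Linear (volume.restrict Ω) fun u : Φ =>
      weakGrad Ω ((u : Lp ℝ 2 (volume.restrict Ω)) : E d → ℝ) where
  memLp u := (isWeakGrad_weakGrad (hΦ u u.2).2).1
  add u v := by
    have hu := hΦ u u.2
    have hv := hΦ v v.2
    have huv := hΦ _ (u + v).2
    refine (isWeakGrad_weakGrad huv.2).unique hΩ huv.1 ?_
    exact ((isWeakGrad_weakGrad hu.2).add hu.1 hv.1 (isWeakGrad_weakGrad hv.2)).congr_left
      (Lp.coeFn_add _ _).symm
  smul c u := by
    have hu := hΦ u u.2
    have hcu := hΦ _ (c • u).2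
    refine (isWeakGrad_weakGrad hcu.2).unique hΩ hcu.1 ?_
    exact ((isWeakGrad_weakGrad hu.2).const_smul hu.1 c).congr_left (Lp.coeFn_smul _ _).symm

end Potential

theorem memLp_weakGrad (u : E d → ℝ) : MemLp (weakGrad Ω u) 2 (volume.restrict Ω) := by
  unfold weakGrad
  split_ifs with h
  exacts [h.choose_spec.1, MemLp.zero]

section P0

variable (𝒯 : QuadMesh d Ω)

theorem mem_spaceP0_iff {γ : E d → ℝ} : γ ∈ spaceP0 𝒯 ↔ ∃ c : Fin 𝒯.numCells → ℝ,
    ∑ T, c T • (𝒯.openCell T).indicator (fun _ => (1 : ℝ)) = γ :=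
  Submodule.mem_span_range_iff_exists_fun ℝ

theorem isL2Linear_spaceP0 (hΩb : Bornology.IsBounded Ω) :
    IsL2Linear (volume.restrict Ω) fun γ : spaceP0 𝒯 => (γ : E d → ℝ) where
  memLp γ := by
    have := isFiniteMeasure_restrict hΩb
    obtain ⟨c, hc⟩ := (mem_spaceP0_iff 𝒯).1 γ.2
    rw [← hc]
    exact memLp_finsetSum' _ fun T _ =>
      ((memLp_const (1 : ℝ)).indicator (𝒯.isOpen_openCell T).measurableSet).const_smul _
  add _ _ := EventuallyEq.rfl
  smul _ _ := EventuallyEq.rfl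

end P0

section FormsBilin

variable {S : Submodule ℝ (E d → V3)} {μ : Material} {n : E d → V3} {φ lam : E d → ℝ}

theorem isBilin_formElastic (hΩ : IsOpen Ω) (hS : ∀ v : S, IsRegular Ω (v : E d → V3))
    (hn : IsRegular Ω n) (hlam : MemLp lam 2 (volume.restrict Ω)) :
    IsBilin fun u v : S => formElastic μ Ω n lam u v := by
  obtain ⟨C, hC⟩ := hn.ae_bound hΩ
  have hcn := (isWeakCurl_weakCurl hn.1.2.2).1
  have hs := memLp_inner_of_bounded hcn hn.1.1.1 hC
  have hD := isL2Linear_weakDiv hS hΩ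
  have hW := isL2Linear_weakCurl hS hΩ
  have hsv := isL2Linear_smul_val hS hΩ hs
  have hnW := hW.inner_director hΩ hn
  have hvc := isL2Linear_inner_val hS hΩ hcn
  have h3 := hsv.isBilin_inner hW
  have h5 := hW.isBilin_inner hsv
  have h8 := (isL2Linear_smul_val hS hΩ hlam).isBilin_inner (isL2Linear_val hS)
  simp only [real_inner_smul_left] at h3 h8
  simp only [real_inner_smul_right] at h5
  have key := ((((hD.isBilin_mul hD).const_mul μ.K1).add
    (((hW.applyZ hΩ hn μ.kappa).isBilin_inner hW).const_mul μ.K3)).add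
    (((((h3.add (hvc.isBilin_mul hnW)).add h5).add (hnW.isBilin_mul hvc)).add
      (hvc.isBilin_mul hvc)).const_mul (μ.K2 - μ.K3))).add h8
  obtain ⟨B, hB⟩ := key
  refine ⟨B, fun u v => (hB u v).trans ?_⟩
  unfold formElastic
  have e3 : ∀ x, inner ℝ (n x) (weakCurl Ω n x) * inner ℝ (u.1 x) (weakCurl Ω v.1 x) =
      inner ℝ (u.1 x) (weakCurl Ω v.1 x) * inner ℝ (n x) (weakCurl Ω n x) := fun x => mul_comm _ _
  have e4 : ∀ x, inner ℝ (u.1 x) (weakCurl Ω n x) * inner ℝ (n x) (weakCurl Ω v.1 x) =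
      inner ℝ (n x) (weakCurl Ω v.1 x) * inner ℝ (u.1 x) (weakCurl Ω n x) := fun x => mul_comm _ _
  have e5 : ∀ x, inner ℝ (weakCurl Ω u.1 x) (v.1 x) = inner ℝ (v.1 x) (weakCurl Ω u.1 x) :=
    fun x => real_inner_comm _ _
  simp only [e3, e4, e5]

theorem isBilin_formA (hΩ : IsOpen Ω) (hS : ∀ v : S, IsRegular Ω (v : E d → V3))
    (hn : IsRegular Ω n) (hlam : MemLp lam 2 (volume.restrict Ω)) :
    IsBilin fun u v : S => formA μ Ω n φ lam u v := by
  have h := isL2Linear_inner_val hS hΩ (memLp_weakGrad φ)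
  exact (isBilin_formElastic hΩ hS hn hlam).sub ((h.isBilin_mul h).const_mul _)

theorem isBilin_formB1 {Φ : Submodule ℝ (Lp ℝ 2 (volume.restrict Ω))} (hΩ : IsOpen Ω)
    (hS : ∀ v : S, IsRegular Ω (v : E d → V3)) (hn : IsRegular Ω n)
    (hΦ : ∀ u ∈ Φ, MemH1 Ω u) :
    IsBilin fun (v : S) (u : Φ) =>
      formB1 μ Ω n φ v ((u : Lp ℝ 2 (volume.restrict Ω)) : E d → ℝ) := by
  obtain ⟨C, hC⟩ := hn.ae_bound hΩ
  have hG := isL2Linear_weakGrad hΩ hΦ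
  have h1 := (isL2Linear_smul_val hS hΩ
    (memLp_inner_of_bounded (memLp_weakGrad φ) hn.1.1.1 hC)).isBilin_inner hG
  simp only [real_inner_smul_left] at h1
  have h2 := (isL2Linear_inner_val hS hΩ (memLp_weakGrad φ)).isBilin_mul (hG.inner_director hΩ hn)
  obtain ⟨B, hB⟩ := (h1.const_mul (-μ.eps0 * μ.epsA)).sub (h2.const_mul (μ.eps0 * μ.epsA))
  refine ⟨B, fun v u => (hB v u).trans ?_⟩
  unfold formB1
  have e : ∀ x, inner ℝ (n x) (weakGrad Ω u.1 x) * inner ℝ (v.1 x) (weakGrad Ω φ x) =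
      inner ℝ (v.1 x) (weakGrad Ω φ x) * inner ℝ (n x) (weakGrad Ω u.1 x) := fun x => mul_comm _ _
  simp only [e]

theorem isBilin_formB2 {𝒯 : QuadMesh d Ω} (hΩ : IsOpen Ω) (hΩb : Bornology.IsBounded Ω)
    (hS : ∀ v : S, IsRegular Ω (v : E d → V3)) (hn : IsRegular Ω n) :
    IsBilin fun (v : S) (γ : spaceP0 𝒯) => formB2 Ω n v γ := by
  obtain ⟨B, hB⟩ := ((isL2Linear_val hS).inner_director hΩ hn).isBilin_mul
    (isL2Linear_spaceP0 𝒯 hΩb)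
  refine ⟨B, fun v u => (hB v u).trans ?_⟩
  exact integral_congr_ae (Eventually.of_forall fun x => mul_comm _ _)

theorem isBilin_formC {Φ : Submodule ℝ (Lp ℝ 2 (volume.restrict Ω))} (hΩ : IsOpen Ω)
    (hn : IsRegular Ω n) (hΦ : ∀ u ∈ Φ, MemH1 Ω u) :
    IsBilin fun u w : Φ => formC μ Ω n ((u : Lp ℝ 2 (volume.restrict Ω)) : E d → ℝ)
      ((w : Lp ℝ 2 (volume.restrict Ω)) : E d → ℝ) := by
  have hG := isL2Linear_weakGrad hΩ hΦ
  have h := hG.inner_director hΩ hn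
  exact ((hG.isBilin_inner hG).const_mul _).add ((h.isBilin_mul h).const_mul _)

end FormsBilin

/-! ### The Poincaré inequality and positivity of the diagonal blocks -/

/-- The Poincaré inequality for test functions on a bounded set. It follows from the identity
`∫ ψ² = -2 ∫ x₀ ψ ∂₀ψ`. -/
theorem IsTest.poincare (hd : 0 < d) (hΩ : IsOpen Ω) (hΩb : Bornology.IsBounded Ω) :
    ∃ K : ℝ, 0 ≤ K ∧ ∀ ψ : E d → ℝ, IsTest Ω ψ →
      ∫ x in Ω, ψ x ^ 2 ≤ K ^ 2 * ∫ x in Ω, ‖grad ψ x‖ ^ 2 := by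
  obtain ⟨R, hR⟩ := hΩb.exists_norm_le
  refine ⟨2 * |R|, by positivity, fun ψ hψ => ?_⟩
  have hψd : ∀ x, DifferentiableAt ℝ ψ x := fun x => hψ.1.differentiable (by simp) x
  set c : E d → ℝ := fun x => x ⟨0, hd⟩ with hcdef
  have hc : ∀ x, HasFDerivAt c (EuclideanSpace.proj (𝕜 := ℝ) (⟨0, hd⟩ : Fin d)) x := fun x =>
    (EuclideanSpace.proj (𝕜 := ℝ) (⟨0, hd⟩ : Fin d)).hasFDerivAt
  have hψ2 : IsTest Ω fun x => (c x * ψ x) * ψ x :=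
    ⟨((contDiff_coord _).mul hψ.1).mul hψ.1, hψ.2.1.mul_left,
      tsupport_mul_subset_right.trans hψ.2.2⟩
  -- the integral of `∂₀ (x₀ ψ²) = ψ² + 2 x₀ ψ ∂₀ψ` vanishes
  have hpd : ∀ x, pd 0 (fun x => (c x * ψ x) * ψ x) x =
      ψ x ^ 2 + 2 * (c x * ψ x * pd 0 ψ x) := fun x => by
    have h1 : HasFDerivAt (fun x => (c x * ψ x) * ψ x) _ x :=
      ((hc x).fun_mul (hψd x).hasFDerivAt).fun_mul (hψd x).hasFDerivAt
    rw [pd_eq_fderiv, pd_eq_fderiv, h1.fderiv]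
    simp [dir, hd]
    ring
  have hgrad := hψ.memLp_grad
  have hpdL : MemLp (pd 0 ψ) 2 (volume.restrict Ω) :=
    (hψ.continuous_pd 0).memLp_of_hasCompactSupport (hψ.hasCompactSupport_pd 0)
  have i1 : Integrable (fun x => ψ x ^ 2) (volume.restrict Ω) := hψ.memLp.integrable_sq
  have i2 : Integrable (fun x => c x * ψ x * pd 0 ψ x) (volume.restrict Ω) := by
    refine integrable_mul_of_memLp ?_ hpdL
    exact ((contDiff_coord (k := 0) _).continuous.mul
      hψ.1.continuous).memLp_of_hasCompactSupport hψ.2.1.mul_left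
  have i3 : Integrable (fun x => ‖grad ψ x‖ ^ 2) (volume.restrict Ω) := hgrad.norm.integrable_sq
  have h0 := hψ2.integral_pd 0
  simp only [hpd] at h0
  rw [integral_add i1 (i2.const_mul 2), integral_const_mul] at h0
  have hmono : ∫ x in Ω, -2 * (c x * ψ x * pd 0 ψ x) ≤
      ∫ x in Ω, (1 / 2 * ψ x ^ 2 + 2 * |R| ^ 2 * ‖grad ψ x‖ ^ 2) := by
    refine setIntegral_mono_on (i2.const_mul _) ((i1.const_mul _).add (i3.const_mul _))
      hΩ.measurableSet fun x hx => ?_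
    have hcx : |c x| ≤ |R| :=
      (PiLp.norm_apply_le x _).trans ((hR x hx).trans (le_abs_self R))
    have hp : |pd 0 ψ x| ≤ ‖grad ψ x‖ := by
      rw [← grad_apply, ← Real.norm_eq_abs]
      exact PiLp.norm_apply_le _ _
    have h1 : |c x * pd 0 ψ x| ≤ |R| * ‖grad ψ x‖ := by
      rw [abs_mul]; gcongr
    have h2 : (c x * pd 0 ψ x) ^ 2 ≤ (|R| * ‖grad ψ x‖) ^ 2 := sq_le_sq' (abs_le.1 h1).1 (abs_le.1 h1).2
    nlinarith [sq_nonneg (ψ x + 2 * (c x * pd 0 ψ x))]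
  rw [integral_add (i1.const_mul _) (i3.const_mul _), integral_const_mul, integral_const_mul,
    integral_const_mul] at hmono
  linarith

theorem eLpNorm_two_eq {α F : Type*} [MeasurableSpace α] {ν : Measure α} [NormedAddCommGroup F]
    {f : α → F} (hf : MemLp f 2 ν) :
    eLpNorm f 2 ν = ENNReal.ofReal √(∫ x, ‖f x‖ ^ 2 ∂ν) := by
  rw [hf.eLpNorm_eq_integral_rpow_norm (by norm_num) (by norm_num), Real.sqrt_eq_rpow]
  norm_num

/-- A function of `H¹₀(Ω)` with vanishing gradient vanishes. -/
theorem MemH10.ae_eq_zero (hd : 0 < d) (hΩ : IsOpen Ω) (hΩb : Bornology.IsBounded Ω)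
    {u : E d → ℝ} (hu : MemH10 Ω u) (hg : weakGrad Ω u =ᵐ[volume.restrict Ω] 0) :
    u =ᵐ[volume.restrict Ω] 0 := by
  obtain ⟨K, hK0, hK⟩ := IsTest.poincare hd hΩ hΩb
  rw [← eLpNorm_eq_zero_iff hu.1.1.1 (p := 2) (by norm_num)]
  have hle : ∀ ε : ENNReal, 0 < ε → eLpNorm u 2 (volume.restrict Ω) ≤
      (1 + ENNReal.ofReal K) * ε := fun ε hε => by
    obtain ⟨ψ, hψ, h1, h2⟩ := hu.2 ε hε
    have h3 : eLpNorm (grad ψ) 2 (volume.restrict Ω) ≤ ε := by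
      refine le_trans (le_of_eq ?_) h2
      rw [← eLpNorm_neg]
      refine eLpNorm_congr_ae ?_
      filter_upwards [hg] with x hx
      simp [hx]
    have h4 : eLpNorm ψ 2 (volume.restrict Ω) ≤
        ENNReal.ofReal K * eLpNorm (grad ψ) 2 (volume.restrict Ω) := by
      rw [eLpNorm_two_eq hψ.memLp, eLpNorm_two_eq hψ.memLp_grad, ← ENNReal.ofReal_mul hK0]
      refine ENNReal.ofReal_le_ofReal ?_
      rw [← Real.sqrt_sq hK0, ← Real.sqrt_mul (sq_nonneg _)]
      refine Real.sqrt_le_sqrt ?_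
      simpa using hK ψ hψ
    calc eLpNorm u 2 (volume.restrict Ω)
        = eLpNorm ((fun x => u x - ψ x) + ψ) 2 (volume.restrict Ω) := by
          congr 1; funext x; simp
      _ ≤ eLpNorm (fun x => u x - ψ x) 2 (volume.restrict Ω) + eLpNorm ψ 2 (volume.restrict Ω) :=
          eLpNorm_add_le (hu.1.1.sub hψ.memLp).1 hψ.memLp.1 (by norm_num)
      _ ≤ ε + ENNReal.ofReal K * ε := add_le_add h1 (h4.trans (by gcongr))
      _ = (1 + ENNReal.ofReal K) * ε := by rw [add_mul, one_mul]
  have hc : (1 + ENNReal.ofReal K) ≠ ⊤ := by simp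
  have hc0 : (1 + ENNReal.ofReal K) ≠ 0 := by simp
  refine nonpos_iff_eq_zero.1 (le_of_forall_gt fun δ hδ => ?_)
  obtain ⟨δ', h1, h2⟩ := exists_between hδ
  refine (hle (δ' / (1 + ENNReal.ofReal K)) (ENNReal.div_pos h1.ne' hc)).trans_lt ?_
  rwa [ENNReal.mul_div_cancel hc0 hc]

theorem ae_eq_zero_of_integral_norm_sq_nonpos {α F : Type*} [MeasurableSpace α] {ν : Measure α}
    [NormedAddCommGroup F] {f : α → F} (hf : MemLp f 2 ν) (h : ∫ x, ‖f x‖ ^ 2 ∂ν ≤ 0) :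
    f =ᵐ[ν] 0 := by
  have h0 := (integral_eq_zero_iff_of_nonneg (fun x => sq_nonneg ‖f x‖) hf.norm.integrable_sq).1
    (le_antisymm h (integral_nonneg fun x => sq_nonneg _))
  filter_upwards [h0] with x hx
  simpa using hx

theorem ae_norm_le_toReal_eLpNorm_top {α F : Type*} [MeasurableSpace α] {ν : Measure α}
    [NormedAddCommGroup F] {f : α → F} (hf : MemLp f ⊤ ν) :
    ∀ᵐ x ∂ν, ‖f x‖ ≤ (eLpNorm f ⊤ ν).toReal := by
  filter_upwards [ae_le_eLpNormEssSup (f := f) (μ := ν)] with x hx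
  rw [← eLpNorm_exponent_top] at hx
  simpa using ENNReal.toReal_mono hf.2.ne hx

/-- The form `c(u, u)` controls the `L²` norm of the gradient. If the anisotropy is negative, this
is where the smallness of the director enters. -/
theorem exists_formC_ge (hΩ : IsOpen Ω) {μ : Material} {n : E d → V3} (hn : IsRegular Ω n)
    (hneg : μ.epsA < 0 → ∃ β : ℝ, (∀ x ∈ Ω, ‖n x‖ ^ 2 ≤ β) ∧ β < μ.epsPerp / |μ.epsA|) :
    ∃ c : ℝ, 0 < c ∧ ∀ u : E d → ℝ,
      c * ∫ x in Ω, ‖weakGrad Ω u x‖ ^ 2 ≤ formC μ Ω n u u := by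
  have h0 := μ.eps0_pos
  have hp := μ.epsPerp_pos
  obtain ⟨C, hC⟩ := hn.ae_bound hΩ
  have hsq : ∀ u : E d → ℝ, formC μ Ω n u u =
      μ.eps0 * μ.epsPerp * (∫ x in Ω, ‖weakGrad Ω u x‖ ^ 2) +
        μ.eps0 * μ.epsA * ∫ x in Ω, inner ℝ (n x) (weakGrad Ω u x) ^ 2 := fun u => by
    unfold formC
    simp only [real_inner_self_eq_norm_sq, ← sq]
  rcases le_or_gt 0 μ.epsA with ha | ha
  · refine ⟨μ.eps0 * μ.epsPerp, by positivity, fun u => ?_⟩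
    rw [hsq]
    have : 0 ≤ ∫ x in Ω, inner ℝ (n x) (weakGrad Ω u x) ^ 2 :=
      integral_nonneg fun x => sq_nonneg _
    have := mul_nonneg (mul_nonneg h0.le ha) this
    linarith
  · obtain ⟨β, hβ, hβ'⟩ := hneg ha
    rw [lt_div_iff₀ (abs_pos.2 ha.ne), abs_of_neg ha] at hβ'
    refine ⟨μ.eps0 * (μ.epsPerp - β * -μ.epsA), mul_pos h0 (by linarith), fun u => ?_⟩
    rw [hsq]
    have hg := memLp_weakGrad (Ω := Ω) u
    have h1 : ∫ x in Ω, inner ℝ (n x) (weakGrad Ω u x) ^ 2 ≤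
        ∫ x in Ω, β * ‖weakGrad Ω u x‖ ^ 2 := by
      refine setIntegral_mono_on (memLp_inner_of_bounded hg hn.1.1.1 hC).integrable_sq
        (hg.norm.integrable_sq.const_mul β) hΩ.measurableSet fun x hx => ?_
      have h2 := abs_real_inner_le_norm (n x) (weakGrad Ω u x)
      calc (inner ℝ (n x) (weakGrad Ω u x) : ℝ) ^ 2 ≤ (‖n x‖ * ‖weakGrad Ω u x‖) ^ 2 :=
            sq_le_sq' (abs_le.1 h2).1 (abs_le.1 h2).2
        _ = ‖n x‖ ^ 2 * ‖weakGrad Ω u x‖ ^ 2 := mul_pow _ _ _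
        _ ≤ β * ‖weakGrad Ω u x‖ ^ 2 := by gcongr; exact hβ x hx
    rw [integral_const_mul] at h1
    have := mul_le_mul_of_nonneg_left h1 (mul_nonneg h0.le (neg_nonneg.2 ha.le))
    nlinarith

/-- If the elastic form is coercive, then `a(v, v)` controls the `L²` norm of `v`. -/
theorem exists_formA_ge (hΩ : IsOpen Ω) {μ : Material} {n : E d → V3} {φ lam : E d → ℝ} {α₀ : ℝ}
    (hα₀ : 0 < α₀)
    (hcond : μ.epsA ≤ 0 ∨ (MemLp (weakGrad Ω φ) ⊤ (volume.restrict Ω) ∧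
      0 < α₀ - μ.eps0 * μ.epsA * Cphi Ω φ ^ 2)) :
    ∃ c : ℝ, 0 < c ∧ ∀ v : E d → V3, IsRegular Ω v →
      α₀ * normDCsq Ω v ≤ formElastic μ Ω n lam v v →
      c * ∫ x in Ω, ‖v x‖ ^ 2 ≤ formA μ Ω n φ lam v v := by
  have h0 := μ.eps0_pos
  have hnorm : ∀ v : E d → V3, ∫ x in Ω, ‖v x‖ ^ 2 ≤ normDCsq Ω v := fun v => by
    have h1 : 0 ≤ ∫ x in Ω, weakDiv Ω v x ^ 2 := integral_nonneg fun x => sq_nonneg _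
    have h2 : 0 ≤ ∫ x in Ω, ‖weakCurl Ω v x‖ ^ 2 := integral_nonneg fun x => sq_nonneg _
    unfold normDCsq
    linarith
  by_cases ha : μ.epsA ≤ 0
  · refine ⟨α₀, hα₀, fun v _ hv => ?_⟩
    have h1 := mul_le_mul_of_nonneg_left (hnorm v) hα₀.le
    have h2 : 0 ≤ ∫ x in Ω, inner ℝ (v x) (weakGrad Ω φ x) * inner ℝ (v x) (weakGrad Ω φ x) :=
      integral_nonneg fun x => mul_self_nonneg _
    have h3 := mul_nonneg (mul_nonneg h0.le (neg_nonneg.2 ha)) h2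
    unfold formA
    nlinarith
  · obtain ⟨hφ, hc⟩ := hcond.resolve_left ha
    push Not at ha
    refine ⟨_, hc, fun v hv hv' => ?_⟩
    have h1 := mul_le_mul_of_nonneg_left (hnorm v) hα₀.le
    obtain ⟨D, hD⟩ := hv.ae_bound hΩ
    have hm := memLp_inner_of_bounded (memLp_weakGrad (Ω := Ω) φ) hv.1.1.1 hD
    have h2 : ∫ x in Ω, inner ℝ (v x) (weakGrad Ω φ x) * inner ℝ (v x) (weakGrad Ω φ x) ≤
        ∫ x in Ω, Cphi Ω φ ^ 2 * ‖v x‖ ^ 2 := by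
      refine integral_mono_ae (integrable_mul_of_memLp hm hm)
        (hv.1.1.norm.integrable_sq.const_mul _) ?_
      filter_upwards [ae_norm_le_toReal_eLpNorm_top hφ] with x hx
      have h3 := abs_real_inner_le_norm (v x) (weakGrad Ω φ x)
      rw [← sq]
      calc (inner ℝ (v x) (weakGrad Ω φ x) : ℝ) ^ 2 ≤ (‖v x‖ * ‖weakGrad Ω φ x‖) ^ 2 :=
            sq_le_sq' (abs_le.1 h3).1 (abs_le.1 h3).2
        _ = ‖weakGrad Ω φ x‖ ^ 2 * ‖v x‖ ^ 2 := by ring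
        _ ≤ Cphi Ω φ ^ 2 * ‖v x‖ ^ 2 := by gcongr; exact hx
    rw [integral_const_mul] at h2
    have h3 := mul_le_mul_of_nonneg_left h2 (mul_nonneg h0.le ha.le)
    unfold formA
    nlinarith

/-- A piecewise constant that is `b`-orthogonal to all bubble fields vanishes, since
`b(b_T n, γ) = γ_T ∫ b_T |n|²` for the value `γ_T` of `γ` on `T`. -/
theorem eq_zero_of_formB2_bubble_eq_zero {𝒯 : QuadMesh d Ω} (hΩ : IsOpen Ω)
    (hΩb : Bornology.IsBounded Ω)
    {n : E d → V3} (hnc : ContinuousOn n (closure Ω)) (hn : IsRegular Ω n)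
    (hcell : ∀ T, ∃ x ∈ 𝒯.openCell T, n x ≠ 0) {γ : E d → ℝ} (hγ : γ ∈ spaceP0 𝒯)
    (h : ∀ T, formB2 Ω n (fun x => 𝒯.bubble T x • n x) γ = 0) : γ = 0 := by
  obtain ⟨c, rfl⟩ := (mem_spaceP0_iff 𝒯).1 hγ
  suffices hc : ∀ T, c T = 0 by simp [hc]
  intro T
  have hval : ∀ x, (∑ T', c T' • (𝒯.openCell T').indicator (fun _ => (1 : ℝ))) x *
      inner ℝ (n x) (𝒯.bubble T x • n x) = c T * (𝒯.bubble T x * ‖n x‖ ^ 2) := fun x => by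
    rw [real_inner_smul_right, real_inner_self_eq_norm_sq]
    by_cases hx : x ∈ 𝒯.openCell T
    · rw [Finset.sum_apply, Finset.sum_eq_single T]
      · simp [hx]
      · intro T' _ hT
        have : x ∉ 𝒯.openCell T' := fun h' => (𝒯.disjoint T' T hT).le_bot ⟨h', hx⟩
        simp [this]
      · simp
    · rw [QuadMesh.bubble_of_notMem hx]; simp
  have hT := h T
  unfold formB2 at hT
  simp only [hval, integral_const_mul] at hT
  refine (mul_eq_zero.1 hT).resolve_right fun h0 => ?_
  obtain ⟨C, hC⟩ := QuadMesh.exists_lipschitzWith_bubble (𝒯 := 𝒯) hΩ T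
  have hreg := hn.lipschitz_smul hΩ hΩb hC fun x hx => QuadMesh.bubble_eq_zero_of_notMem hx
  have hint : Integrable (fun x => 𝒯.bubble T x * ‖n x‖ ^ 2) (volume.restrict Ω) := by
    have := integrable_inner_of_memLp hreg.1.1 hn.1.1
    simpa only [real_inner_smul_left, real_inner_self_eq_norm_sq] using this
  have h1 := (integral_eq_zero_iff_of_nonneg
    (fun x => mul_nonneg (QuadMesh.bubble_nonneg T x) (sq_nonneg _)) hint).1 h0
  have h2 := Measure.eqOn_open_of_ae_eq h1 hΩ
    (hC.continuous.continuousOn.mul ((hnc.mono subset_closure).norm.pow 2)) continuousOn_const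
  obtain ⟨x, hx, hnx⟩ := hcell T
  have h3 := h2 (𝒯.openCell_subset T hx)
  have h4 := mul_pos (QuadMesh.bubble_pos hx) (pow_pos (norm_pos_iff.2 hnx) 2)
  exact h4.ne' h3

/-! ### Invertibility of the block matrix -/

/-- A saddle point matrix with positive definite blocks `a` and `c` is invertible if the constraint
form `b₂` is nondegenerate in its second argument. -/
theorem isUnit_saddlePoint {V W P ι₁ ι₂ ι₃ : Type*} [AddCommGroup V] [Module ℝ V]
    [AddCommGroup W] [Module ℝ W] [AddCommGroup P] [Module ℝ P]
    [Fintype ι₁] [Fintype ι₂] [Fintype ι₃] [DecidableEq ι₁] [DecidableEq ι₂] [DecidableEq ι₃]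
    (v : Module.Basis ι₁ ℝ V) (χ : Module.Basis ι₂ ℝ W) (γ : Module.Basis ι₃ ℝ P)
    (a : V →ₗ[ℝ] V →ₗ[ℝ] ℝ) (b₁ : V →ₗ[ℝ] W →ₗ[ℝ] ℝ) (b₂ : V →ₗ[ℝ] P →ₗ[ℝ] ℝ)
    (c : W →ₗ[ℝ] W →ₗ[ℝ] ℝ) (ha : ∀ x, a x x ≤ 0 → x = 0) (hc : ∀ y, c y y ≤ 0 → y = 0)
    (ha0 : ∀ x, 0 ≤ a x x) (hc0 : ∀ y, 0 ≤ c y y) (hb : ∀ z, (∀ x, b₂ x z = 0) → z = 0) :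
    IsUnit (Matrix.fromBlocks (Matrix.of fun i j => a (v j) (v i))
      (Matrix.fromCols (Matrix.of fun i j => b₁ (v i) (χ j)) (Matrix.of fun i j => b₂ (v i) (γ j)))
      (Matrix.fromRows (Matrix.of fun i j => b₁ (v i) (χ j)).transpose
        (Matrix.of fun i j => b₂ (v i) (γ j)).transpose)
      (Matrix.fromBlocks (-(Matrix.of fun i j => c (χ j) (χ i))) 0 0 0)) := by
  rw [← Matrix.mulVec_injective_iff_isUnit, ← Matrix.coe_mulVecLin,
    injective_iff_map_eq_zero]
  intro s hs
  rw [Matrix.mulVecLin_apply] at hs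
  set x := ∑ i, s (Sum.inl i) • v i with hx
  set y := ∑ j, s (Sum.inr (Sum.inl j)) • χ j with hy
  set z := ∑ k, s (Sum.inr (Sum.inr k)) • γ k with hz
  have r1 : a x + b₁.flip y + b₂.flip z = 0 := by
    refine v.ext fun i => ?_
    have := congr_fun hs (Sum.inl i)
    simpa [Matrix.mulVec, dotProduct, hx, hy, hz, Fintype.sum_sum_type, mul_comm, add_assoc]
      using this
  have r2 : b₁ x - c y = 0 := by
    refine χ.ext fun j => ?_
    have := congr_fun hs (Sum.inr (Sum.inl j))
    simpa [Matrix.mulVec, dotProduct, hx, hy, Fintype.sum_sum_type, mul_comm, sub_eq_add_neg]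
      using this
  have r3 : b₂ x = 0 := by
    refine γ.ext fun k => ?_
    have := congr_fun hs (Sum.inr (Sum.inr k))
    simpa [Matrix.mulVec, dotProduct, hx, Fintype.sum_sum_type, mul_comm] using this
  have e1 : a x x + b₁ x y + b₂ x z = 0 := by simpa using LinearMap.congr_fun r1 x
  have e2 : b₁ x y - c y y = 0 := by simpa using LinearMap.congr_fun r2 y
  have e3 : b₂ x z = 0 := by simpa using LinearMap.congr_fun r3 z
  have hx0 : x = 0 := ha x (by linarith [hc0 y])
  have hy0 : y = 0 := hc y (by linarith [ha0 x])
  have hz0 : z = 0 := hb z fun x' => by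
    have := LinearMap.congr_fun r1 x'
    simpa [hx0, hy0] using this
  have k1 := Fintype.linearIndependent_iff.1 v.linearIndependent _ hx0
  have k2 := Fintype.linearIndependent_iff.1 χ.linearIndependent _ hy0
  have k3 := Fintype.linearIndependent_iff.1 γ.linearIndependent _ hz0
  funext q
  rcases q with i | j | k
  exacts [k1 i, k2 j, k3 k]

end NematicFE

theorem theorem4p3
    (d : ℕ) (hd : d = 2 ∨ d = 3)
    (Ω : Set (E d)) (hΩ : IsOpen Ω) (hΩconn : IsConnected Ω) (hΩbdd : Bornology.IsBounded Ω)
    (μ : Material)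
    -- the current approximations
    (n : E d → V3) (hn : MemHDC Ω n) (hnc : ContinuousOn n (closure Ω))
    (φ : E d → ℝ) (hφ : MemH1 Ω φ)
    (lam : E d → ℝ) (hlam : MemLp lam 2 (volume.restrict Ω))
    -- smallness of the director if the dielectric anisotropy is negative
    (hneg : μ.epsA < 0 → ∃ β : ℝ, (∀ x ∈ Ω, ‖n x‖ ^ 2 ≤ β) ∧ β < μ.epsPerp / |μ.epsA|)
    -- the subdivision, the finite-element spaces and their bases
    (𝒯 : QuadMesh d Ω) (m : ℕ) (hm : 1 ≤ m)
    (hcell : ∀ T, ∃ x ∈ 𝒯.openCell T, n x ≠ 0)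
    (Φ : Submodule ℝ (Lp ℝ 2 (volume.restrict Ω))) (hΦ : ∀ u ∈ Φ, MemH10 Ω u)
    {ι₁ ι₂ ι₃ : Type*} [Fintype ι₁] [Fintype ι₂] [Fintype ι₃]
    [DecidableEq ι₁] [DecidableEq ι₂] [DecidableEq ι₃]
    (v : Module.Basis ι₁ ℝ (spaceV 𝒯 m n)) (χ : Module.Basis ι₂ ℝ Φ)
    (γ : Module.Basis ι₃ ℝ (spaceP0 𝒯))
    -- the coercivity constant of the elastic form
    (α₀ : ℝ) (hα₀ : 0 < α₀)
    (hcoer : ∀ w ∈ spaceV 𝒯 m n, α₀ * normDCsq Ω w ≤ formElastic μ Ω n lam w w)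
    (hcond : μ.epsA ≤ 0 ∨
      (MemLp (weakGrad Ω φ) ⊤ (volume.restrict Ω) ∧
        0 < α₀ - μ.eps0 * μ.epsA * Cphi Ω φ ^ 2)) :
    IsUnit (hessianMatrix μ Ω n φ lam (fun i => (v i : E d → V3))
      (fun j => (((χ j : Φ) : Lp ℝ 2 (volume.restrict Ω)) : E d → ℝ))
      (fun k => (γ k : E d → ℝ))) := by 
  have hd0 : 0 < d := by omega
  have hnr : IsRegular Ω n := isRegular_director hΩbdd hn hnc
  have hS : ∀ w : spaceV 𝒯 m n, IsRegular Ω (w : E d → V3) := fun w =>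
    isRegular_of_mem_spaceV hΩ hΩbdd hnr w.2
  have hΦ1 : ∀ u ∈ Φ, MemH1 Ω u := fun u hu => (hΦ u hu).1
  obtain ⟨a, ha⟩ := isBilin_formA (μ := μ) (φ := φ) hΩ hS hnr hlam
  obtain ⟨b₁, hb₁⟩ := isBilin_formB1 (μ := μ) (φ := φ) hΩ hS hnr hΦ1
  obtain ⟨b₂, hb₂⟩ := isBilin_formB2 (𝒯 := 𝒯) hΩ hΩbdd hS hnr
  obtain ⟨c, hc⟩ := isBilin_formC (μ := μ) hΩ hnr hΦ1
  obtain ⟨cA, hcA, hA⟩ := exists_formA_ge (lam := lam) hΩ (n := n) hα₀ hcond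
  obtain ⟨cC, hcC, hC⟩ := exists_formC_ge hΩ hnr hneg
  have hA' := fun w : spaceV 𝒯 m n => hA w (hS w) (hcoer w w.2)
  have key := isUnit_saddlePoint v χ γ a b₁ b₂ c (fun w hw => ?_) (fun u hu => ?_) (fun w => ?_)
    (fun u => ?_) (fun g hg => ?_)
  · simp only [ha, hb₁, hb₂, hc] at key
    exact key
  · rw [ha] at hw
    have h0 := ae_eq_zero_of_integral_norm_sq_nonpos (hS w).1.1
      (nonpos_of_mul_nonpos_right ((hA' w).trans hw) hcA)
    have h1 := Measure.eqOn_open_of_ae_eq h0 hΩ (continuousOn_of_mem_spaceV w.2)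
      continuousOn_const
    refine Subtype.ext (funext fun x => ?_)
    by_cases hx : x ∈ Ω
    exacts [h1 hx, eq_zero_of_mem_spaceV hΩ w.2 hx]
  · rw [hc] at hu
    have h0 := ae_eq_zero_of_integral_norm_sq_nonpos (memLp_weakGrad _)
      (nonpos_of_mul_nonpos_right ((hC _).trans hu) hcC)
    exact Subtype.ext ((Lp.eq_zero_iff_ae_eq_zero).2 ((hΦ u u.2).ae_eq_zero hd0 hΩ hΩbdd h0))
  · rw [ha]
    exact (mul_nonneg hcA.le (integral_nonneg fun x => sq_nonneg _)).trans (hA' w)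
  · rw [hc]
    exact (mul_nonneg hcC.le (integral_nonneg fun x => sq_nonneg _)).trans (hC _)
  · refine Subtype.ext (eq_zero_of_formB2_bubble_eq_zero hΩ hΩbdd hnc hnr hcell g.2 fun T => ?_)
    rw [← hg ⟨_, bubble_smul_mem_spaceV (m := m) hΩ hnc T⟩, hb₂]
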